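/- A Markov random field instance $\mathbb M=(\mathbb G,\mathcal X,\phi,f)$ consists of a finite simple graph $\mathbb G=(V,E)$ with maximum degree $\Delta$, a finite non-empty alphabet $\mathcal X$, node potentials $\phi_v:\mathcal X\to(0,\infty)$, $v\in V$, and edge potentials $f_{u,v}:\mathcal X\times\mathcal X\to(0,\infty)$, $(u,v)\in E$, with $f_{u,v}(x,y)=f_{v,u}(y,x)$. Its partition function is $$Z_{\mathbb M}=\sum_{\mathbf x\in\mathcal X^{V}}\ \prod_{v\in V}\phi_v(x_v)\prod_{(u,v)\in E}f_{u,v}(x_u,x_v).$$ Let $\phi_{\max},\phi_{\min},f_{\max},f_{\min}$ be the largest and smallest values of the potentials, $c_f=f_{\max}/f_{\min}$, $\gamma=(c_f^{\Delta}-c_f^{-\Delta})\,\Delta\,|\mathcal X|^{\Delta}$ (so $\gamma=0$ if $E=\emptyset$), and let the size of $\mathbb M$ be $$n=\max\big(|V|,|E|,|\mathcal X|,|\log\phi_{\max}|,|\log\phi_{\min}^{-1}|,|\log f_{\max}|,|\log f_{\min}^{-1}|\big),$$ where terms involving an empty set of potentials count as $0$. For a set $S\subseteq V$ of surviving nodes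 and current node potentials $\psi$, and a node $v$ with letter $x$, let $\psi^{v\to x}$ be given by $\psi^{v\to x}_u(y)=\psi_u(y)f_{v,u}(x,y)$ if $u$ is a neighbour of $v$, and $\psi^{v\to x}_u=\psi_u$ otherwise. Define $\Phi_{S,\psi}(v,x,0)=1$ and, for $d\ge1$, $$\Phi_{S,\psi}(v,x_0,d)=\frac{\psi_v(x_0)A(x_0)}{\sum_{x\in\mathcal X}\psi_v(x)A(x)},\qquad A(x)=\sum_{x_1,\dots,x_m\in\mathcal X}\ \prod_{k=1}^m f_{v,v_k}(x,x_k)\,\Phi_{S_k,\psi_k}(v_k,x_k,d-1),$$ where $v_1,\dots,v_m$ are the neighbours of $v$ in $S$ in increasing order (for a fixed numbering of the nodes), $S_k=S\setminus\{v,v_1,\dots,v_{k-1}\}$ and $\psi_k=\psi^{v_1\to x_1,\dots,v_{k-1}\to x_{k-1}}$ (and $A=1$ if $m=0$). Algorithm ComputeZ with parameter $d$ starts with $\hat Z=1$, $S=V$, $\psi=\phi$ and, while $S\ne\emptyset$, picks an arbitrary $v\in S$ and $x\in\mathcal X$, multiplies $\hat Z$ by $\psi_v(x)/\Phi_{S,\psi}(v,x,d)$,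 and replaces $(S,\psi)$ by $(S\setminus\{v\},\psi^{v\to x})$; its output is $\hat Z$. **Theorem.** There is a single deterministic algorithm (a uniform program performing exact arithmetic operations and comparisons on real numbers at unit cost) which is an FPTAS for $Z_{\mathbb M}$ on the instances with $\gamma<1$, whenever $|\mathcal X|$ and $\Delta$ are bounded by constants. More precisely, for all $q\ge1$ and $\Delta_0\ge0$ there is a constant $C$, depending only on $q$ and $\Delta_0$, such that for every instance $\mathbb M$ with $|\mathcal X|=q$, $\Delta\le\Delta_0$, strictly positive potentials and $\gamma<1$, and every $\delta>0$, the algorithm, given $\mathbb M$ and $\delta$, halts after at most $C\,(n+1/\delta)^{C}$ steps with an output $\hat Z$ such that $$1-\delta\le\frac{\hat Z}{Z_{\mathbb M}}\le1+\delta .$$ Moreover, $\hat Z$ is the output of ComputeZ with some positive integer parameter $d\le C\log(1+n+1/\delta)$ (in particular $d=O(\log n)$ for fixed $\delta$) and some resolution of the arbitrary choices of ComputeZ; and the output of ComputeZ with this $d$ satisfies the same two-sided bound for every resolution of these choices. -/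

import Mathlib

/-! ## Markov random fields -/

/-- A Markov random field with nodes `Fin N` and alphabet `Fin q`: a simple graph, a potential
`φ v` on the alphabet for every node, and a potential `f u v` on pairs of letters for every edge
(`f u v x y` is the weight of the edge when `u` has letter `x` and `v` has letter `y`; it does not
depend on the direction in which the edge is read, and values off the edges are never used). -/
structure MRF (N q : ℕ) where
  graph : SimpleGraph (Fin N)
  φ : Fin N → Fin q → ℝ
  f : Fin N → Fin N → Fin q → Fin q → ℝ
  f_symm : ∀ u v, graph.Adj u v → ∀ x y, f u v x y = f v u y x

namespace MRF

variable {N q : ℕ}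

open Classical in
/-- The partition function; every edge is taken once, as a pair `u < v`. -/
noncomputable def Z (M : MRF N q) : ℝ :=
  ∑ x : Fin N → Fin q, (∏ v, M.φ v (x v)) *
    ∏ e : Fin N × Fin N with e.1 < e.2 ∧ M.graph.Adj e.1 e.2, M.f e.1 e.2 (x e.1) (x e.2)

open Classical in
/-- The maximum degree `Δ` of the graph. -/
noncomputable def maxDegree (M : MRF N q) : ℕ := M.graph.maxDegree

/-- The (finite) set of values of the node potentials. -/
def phiValues (M : MRF N q) : Set ℝ := {r | ∃ v x, r = M.φ v x}

/-- The (finite) set of values of the edge potentials on the edges. -/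
def fValues (M : MRF N q) : Set ℝ := {r | ∃ u v x y, M.graph.Adj u v ∧ r = M.f u v x y}

noncomputable def phiMax (M : MRF N q) : ℝ := sSup M.phiValues
noncomputable def phiMin (M : MRF N q) : ℝ := sInf M.phiValues
noncomputable def fMax (M : MRF N q) : ℝ := sSup M.fValues
noncomputable def fMin (M : MRF N q) : ℝ := sInf M.fValues

noncomputable def cf (M : MRF N q) : ℝ := M.fMax / M.fMin

/-- `γ = (c_f ^ Δ - c_f ^ (-Δ)) Δ |X| ^ Δ`; it is `0` for a graph without edges. -/
noncomputable def gamma (M : MRF N q) : ℝ :=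
  (M.cf ^ M.maxDegree - (M.cf ^ M.maxDegree)⁻¹) * M.maxDegree * (q : ℝ) ^ M.maxDegree

/-- The size of an instance: the maximum of `|V|`, `|E|`, `|X|`, `|log φ_max|`, `|log φ_min⁻¹|`,
`|log f_max|` and `|log f_min⁻¹|`. The logarithms for an empty set of values count as `0`. -/
noncomputable def size (M : MRF N q) : ℝ :=
  max (N : ℝ) <| max (M.graph.edgeSet.ncard : ℝ) <| max (q : ℝ) <|
    max |Real.log M.phiMax| <| max |Real.log M.phiMin⁻¹| <|
    max |Real.log M.fMax| |Real.log M.fMin⁻¹|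

/-! ### The algorithm ComputeZ

During the algorithm the graph is always an induced subgraph of the original one and the edge
potentials are unchanged, so that an intermediate instance is given by the set `S` of the nodes
that are left and by the current node potentials `ψ`. -/

open Classical in
/-- Fix node `v` to letter `x`: every neighbour `u` of `v` absorbs the factor `f_{v,u}(x, ·)`. -/
noncomputable def pin (M : MRF N q) (v : Fin N) (x : Fin q) (ψ : Fin N → Fin q → ℝ) :
    Fin N → Fin q → ℝ :=
  fun u y => if M.graph.Adj v u then ψ u y * M.f v u x y else ψ u y

open Classical in
/-- The neighbours of `v` in `S`, in increasing order. -/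
noncomputable def nbrs (M : MRF N q) (S : Finset (Fin N)) (v : Fin N) : List (Fin N) :=
  (List.finRange N).filter fun u => u ∈ S ∧ M.graph.Adj v u

/-- For `v₁, …, v_m` the given list, the sum over all `x₁, …, x_m` of
`∏ k, f_{v,v_k}(x₀, x_k) * Ψ (instance after v₁ ↦ x₁, …, v_{k-1} ↦ x_{k-1} are fixed) v_k x_k`,
written as an iterated sum; it is `1` for `m = 0`. -/
noncomputable def iterSum (M : MRF N q)
    (Ψ : Finset (Fin N) → (Fin N → Fin q → ℝ) → Fin N → Fin q → ℝ) (v : Fin N) (x₀ : Fin q) :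
    List (Fin N) → Finset (Fin N) → (Fin N → Fin q → ℝ) → ℝ
  | [], _, _ => 1
  | u :: us, S, ψ =>
      ∑ y, M.f v u x₀ y * Ψ S ψ u y * iterSum M Ψ v x₀ us (S.erase u) (M.pin u y ψ)

/-- The surrogate `Φ(v, x₀, d)` for the marginal probability of `X_v = x₀`, in the instance given
by `S` and `ψ`. -/
noncomputable def Phi (M : MRF N q) :
    ℕ → Finset (Fin N) → (Fin N → Fin q → ℝ) → Fin N → Fin q → ℝ
  | 0, _, _, _, _ => 1
  | d + 1, S, ψ, v, x₀ =>
      ψ v x₀ * M.iterSum (Phi M d) v x₀ (M.nbrs S v) (S.erase v) ψ /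
        ∑ x, ψ v x * M.iterSum (Phi M d) v x (M.nbrs S v) (S.erase v) ψ

/-- The loop of ComputeZ; the list holds the node `v` and the letter `x` chosen in each round. -/
noncomputable def computeZAux (M : MRF N q) (d : ℕ) :
    List (Fin N × Fin q) → Finset (Fin N) → (Fin N → Fin q → ℝ) → ℝ
  | [], _, _ => 1
  | (v, x) :: L, S, ψ =>
      ψ v x * (M.Phi d S ψ v x)⁻¹ * computeZAux M d L (S.erase v) (M.pin v x ψ)

/-- The output of ComputeZ with depth `d`, for a given sequence of choices. -/
noncomputable def computeZ (M : MRF N q) (d : ℕ) (choices : List (Fin N × Fin q)) : ℝ :=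
  M.computeZAux d choices Finset.univ M.φ

/-- A sequence of choices is admissible if it picks every node exactly once. -/
def Admissible (choices : List (Fin N × Fin q)) : Prop :=
  (choices.map Prod.fst).Perm (List.finRange N)

end MRF

/-! ## Deterministic algorithms over the reals

The model is that of exact real arithmetic at unit cost (as for a real RAM or a BSS machine): first
order recursive programs on list structures whose atoms are real numbers. Besides `+ - * /` and
comparisons of reals there are only pairing, projections, tests, local variables and calls of the
finitely many functions of the program, and each evaluated node of an expression costs one step.
Values are shared and never copied, and an environment has a length bounded by the program, so that
a real RAM carries out a run of cost `t` in `O(t)` steps. The only constants are natural numbers. -/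

namespace RealProg

/-- Data: real numbers, the empty list, and pairs. -/
inductive Val where
  | num (r : ℝ)
  | nil
  | pair (a b : Val)

inductive ArithOp where
  | add | sub | mul | div

inductive Expr where
  /-- the `i`-th local variable, the innermost one first -/
  | var (i : ℕ)
  | const (k : ℕ)
  | nil
  | pair (a b : Expr)
  | fst (a : Expr)
  | snd (a : Expr)
  | arith (op : ArithOp) (a b : Expr)
  /-- if the real numbers `a`, `b` satisfy `a ≤ b` then `s` else `t` -/
  | ifLe (a b s t : Expr)
  /-- if the list `a` is empty then `s` else `t` -/
  | ifNil (a s t : Expr)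
  /-- bind the value of `a` to a new local variable in `b` -/
  | letIn (a b : Expr)
  /-- call the `k`-th function of the program with argument `a` -/
  | call (k : ℕ) (a : Expr)

/-- A program: the finite list of the bodies of its functions, each of one argument. Function `0` is
the main function. -/
abbrev Program := List Expr

/-- `ArithOp.Apply op r s z`: the operation is defined on `r`, `s` with result `z`. Division by
zero is undefined. -/
def ArithOp.Apply : ArithOp → ℝ → ℝ → ℝ → Prop
  | .add, r, s, z => z = r + s
  | .sub, r, s, z => z = r - s
  | .mul, r, s, z => z = r * s
  | .div, r, s, z => s ≠ 0 ∧ z = r / s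

/-- `Eval P env e v t`: in program `P`, with local variables `env`, the evaluation of `e`
terminates with value `v` after `t` steps. Call by value. -/
inductive Eval (P : Program) : List Val → Expr → Val → ℕ → Prop where
  | var {env i v} : env[i]? = some v → Eval P env (.var i) v 1
  | const {env k} : Eval P env (.const k) (.num k) 1
  | nil {env} : Eval P env .nil .nil 1
  | pair {env a b va vb ta tb} : Eval P env a va ta → Eval P env b vb tb →
      Eval P env (.pair a b) (.pair va vb) (ta + tb + 1)
  | fst {env a va vb t} : Eval P env a (.pair va vb) t → Eval P env (.fst a) va (t + 1)
  | snd {env a va vb t} : Eval P env a (.pair va vb) t → Eval P env (.snd a) vb (t + 1)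
  | arith {env op a b r s z ta tb} : Eval P env a (.num r) ta → Eval P env b (.num s) tb →
      op.Apply r s z → Eval P env (.arith op a b) (.num z) (ta + tb + 1)
  | ifLe_true {env a b s t r r' v ta tb tc} : Eval P env a (.num r) ta → Eval P env b (.num r') tb →
      r ≤ r' → Eval P env s v tc → Eval P env (.ifLe a b s t) v (ta + tb + tc + 1)
  | ifLe_false {env a b s t r r' v ta tb tc} : Eval P env a (.num r) ta →
      Eval P env b (.num r') tb → r' < r → Eval P env t v tc →
      Eval P env (.ifLe a b s t) v (ta + tb + tc + 1)
  | ifNil_nil {env a s t v ta tc} : Eval P env a .nil ta → Eval P env s v tc →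
      Eval P env (.ifNil a s t) v (ta + tc + 1)
  | ifNil_pair {env a s t h l v ta tc} : Eval P env a (.pair h l) ta → Eval P env t v tc →
      Eval P env (.ifNil a s t) v (ta + tc + 1)
  | letIn {env a b va v ta tb} : Eval P env a va ta → Eval P (va :: env) b v tb →
      Eval P env (.letIn a b) v (ta + tb + 1)
  | call {env k a va body v ta tb} : Eval P env a va ta → P[k]? = some body →
      Eval P [va] body v tb → Eval P env (.call k a) v (ta + tb + 1)

/-- The evaluation is deterministic: value and number of steps are determined by the input. -/
theorem Eval.unique {P : Program} {env : List Val} {e : Expr} {v w : Val} {t s : ℕ}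
    (h : Eval P env e v t) (h' : Eval P env e w s) : v = w ∧ t = s := by
  induction h generalizing w s with
  | var h => cases h' with | var h' => simp_all
  | const => cases h'; simp
  | nil => cases h'; simp
  | pair _ _ iha ihb =>
    cases h' with | pair h1 h2 =>
    obtain ⟨rfl, rfl⟩ := iha h1
    obtain ⟨rfl, rfl⟩ := ihb h2
    simp
  | fst _ ih =>
    cases h' with | fst h1 =>
    have := ih h1
    simp_all
  | snd _ ih =>
    cases h' with | snd h1 =>
    have := ih h1
    simp_all
  | @arith env op a b r s z ta tb _ _ hop iha ihb =>
    cases h' with | arith h1 h2 hop' =>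
    obtain ⟨e1, rfl⟩ := iha h1
    obtain ⟨e2, rfl⟩ := ihb h2
    cases e1; cases e2
    cases op <;> simp_all [ArithOp.Apply]
  | ifLe_true _ _ hle _ iha ihb ihc =>
    cases h' with
    | ifLe_true h1 h2 _ h3 =>
      obtain ⟨-, rfl⟩ := iha h1
      obtain ⟨-, rfl⟩ := ihb h2
      obtain ⟨rfl, rfl⟩ := ihc h3
      simp
    | ifLe_false h1 h2 hlt _ =>
      have e1 := (iha h1).1
      have e2 := (ihb h2).1
      cases e1; cases e2
      exact absurd hle (not_le.2 hlt)
  | ifLe_false _ _ hlt _ iha ihb ihc =>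
    cases h' with
    | ifLe_true h1 h2 hle _ =>
      have e1 := (iha h1).1
      have e2 := (ihb h2).1
      cases e1; cases e2
      exact absurd hle (not_le.2 hlt)
    | ifLe_false h1 h2 _ h3 =>
      obtain ⟨-, rfl⟩ := iha h1
      obtain ⟨-, rfl⟩ := ihb h2
      obtain ⟨rfl, rfl⟩ := ihc h3
      simp
  | ifNil_nil _ _ iha ihc =>
    cases h' with
    | ifNil_nil h1 h2 =>
      obtain ⟨-, rfl⟩ := iha h1
      obtain ⟨rfl, rfl⟩ := ihc h2
      simp
    | ifNil_pair h1 _ => exact absurd (iha h1).1 (by simp)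
  | ifNil_pair _ _ iha ihc =>
    cases h' with
    | ifNil_nil h1 _ => exact absurd (iha h1).1 (by simp)
    | ifNil_pair h1 h2 =>
      obtain ⟨-, rfl⟩ := iha h1
      obtain ⟨rfl, rfl⟩ := ihc h2
      simp
  | letIn _ _ iha ihb =>
    cases h' with | letIn h1 h2 =>
    obtain ⟨rfl, rfl⟩ := iha h1
    obtain ⟨rfl, rfl⟩ := ihb h2
    simp
  | call _ hb _ iha ihb =>
    cases h' with | call h1 hb' h2 =>
    obtain ⟨rfl, rfl⟩ := iha h1
    rw [hb] at hb'
    cases hb'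
    obtain ⟨rfl, rfl⟩ := ihb h2
    simp

/-- Program `P` halts on `input` with `output` after exactly `t` steps. -/
def Program.Runs (P : Program) (input output : Val) (t : ℕ) : Prop :=
  ∃ body, P[0]? = some body ∧ Eval P [input] body output t

def Val.ofList : List Val → Val
  | [] => .nil
  | v :: l => .pair v (Val.ofList l)

/-- The list of the values of a function on `Fin n`. -/
def Val.table {n : ℕ} (g : Fin n → Val) : Val := Val.ofList ((List.finRange n).map g)

open Classical in
/-- An instance as input: for every node `v` the triple of its number, the table of `φ_v`, and the
list of its neighbours `u` in increasing order, each with the table of `f_{v,u}`. -/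
noncomputable def encodeMRF {N q : ℕ} (M : MRF N q) : Val :=
  Val.table fun v : Fin N => .pair (.num (v : ℕ)) <| .pair (Val.table fun x => .num (M.φ v x)) <|
    Val.ofList <| ((List.finRange N).filter fun u : Fin N => M.graph.Adj v u).map fun u : Fin N =>
      .pair (.num (u : ℕ)) <| Val.table fun x => Val.table fun y => .num (M.f v u x y)

/-- The input consists of the accuracy `δ` and the instance. -/
noncomputable def encodeInput {N q : ℕ} (δ : ℝ) (M : MRF N q) : Val :=
  .pair (.num δ) (encodeMRF M)

end RealProg

/-!
The recursion that defines `MRF.Phi` is satisfied by the exact marginals as well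
(`MRF.marginal_eq`): conditioning on the letters of the neighbours of `v` one after the other is the
chain rule. The surrogate of depth `0` is a crude guess, and the point is that every level of the
recursion contracts the multiplicative error.

The letter `x` of `v` enters `A(x)` only through the edge factors, which tilt a weight on the letters
of the neighbours, and two such tilts are within a factor `K = c_f ^ Δ` of each other
(`MRF.exists_iterSum_eq`). If the weights change by a factor in `[1/G, G]`, the ratio
`A(x) / A(x')` changes at most by the factor `1 + (K² - 1) / (K² + 1) * (G² - 1)`
(`MRF.sum_mul_sum_le_of_ratio`); this is shown by antisymmetrizing a double sum. To first order, an
error factor `exp ε` at the children thus becomes `exp ((K - 1/K) Δ ε)`, and `γ < 1` says that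
`(K - 1/K) Δ < 1 / q ^ Δ ≤ 1/2` unless the claim is trivial because `q = 1` or `Δ = 0`. So although
`γ` may be arbitrarily close to `1`, the contraction is uniform: with the higher order terms,
`7/8` suffices (`MRF.within_marginal_Phi`). Moreover the error at depth `1` is already bounded by
`exp (K - 1/K)`, whatever the node potentials are.

The exact partition function is the product of the numbers `ψ_v(x) / marginal` over the rounds of
ComputeZ. Hence the output of ComputeZ has relative error at most `δ` once
`N (1 + 1/δ) (7/8) ^ (d - 1) ≤ 1` (`MRF.computeZ_accuracy`), and the least such `d` is
logarithmic. The program `RealProg.fptas` finds this `d` by repeated multiplication with `7/8` and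
runs ComputeZ. Its recursion for `Phi` makes a bounded number of calls per level
(`RealProg.phi_spec`), so that the total cost is exponential in `d`, that is, polynomial in the
size and `1/δ`.
-/

namespace MRF

variable {N q : ℕ}

/-! ### The partition function of an intermediate instance -/

/-- The partition function of the instance induced on the nodes of `L`, with node potentials `ψ`:
the nodes are summed out one after the other, in the order of the list. -/
noncomputable def listZ (M : MRF N q) : List (Fin N) → (Fin N → Fin q → ℝ) → ℝ
  | [], _ => 1
  | v :: L, ψ => ∑ y, ψ v y * listZ M L (M.pin v y ψ)

theorem pin_pos {M : MRF N q} (hf : ∀ u v, M.graph.Adj u v → ∀ x y, 0 < M.f u v x y)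
    {ψ : Fin N → Fin q → ℝ} (hψ : ∀ v x, 0 < ψ v x) (v : Fin N) (x : Fin q) :
    ∀ u y, 0 < M.pin v x ψ u y := by
  intro u y
  unfold pin
  split_ifs with h
  · exact mul_pos (hψ u y) (hf v u h x y)
  · exact hψ u y

theorem pin_comm (M : MRF N q) (u v : Fin N) (x y : Fin q) (ψ : Fin N → Fin q → ℝ) :
    M.pin u x (M.pin v y ψ) = M.pin v y (M.pin u x ψ) := by
  funext w z
  unfold pin
  split_ifs <;> ring

theorem listZ_congr (M : MRF N q) (L : List (Fin N)) :
    ∀ ψ ψ' : Fin N → Fin q → ℝ, (∀ u ∈ L, ψ u = ψ' u) → M.listZ L ψ = M.listZ L ψ' := by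
  induction L with
  | nil => intros; rfl
  | cons v L ih =>
    intro ψ ψ' h
    simp only [listZ]
    refine Finset.sum_congr rfl fun y _ => ?_
    rw [h v (by simp), ih (M.pin v y ψ) (M.pin v y ψ')]
    intro u hu
    funext z
    simp only [pin, h u (by simp [hu])]

theorem listZ_swap (M : MRF N q) (u v : Fin N) (L : List (Fin N)) (ψ : Fin N → Fin q → ℝ) :
    M.listZ (u :: v :: L) ψ = M.listZ (v :: u :: L) ψ := by
  simp only [listZ, Finset.mul_sum]
  rw [Finset.sum_comm]
  refine Finset.sum_congr rfl fun y _ => Finset.sum_congr rfl fun x _ => ?_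
  rw [pin_comm M v u y x]
  by_cases h : M.graph.Adj u v
  · simp only [pin, h, h.symm, if_true, M.f_symm u v h x y]
    ring
  · have h' : ¬ M.graph.Adj v u := fun h' => h h'.symm
    simp only [pin, h, h', if_false]
    ring

/-- The nodes may be summed out in any order. -/
theorem listZ_perm (M : MRF N q) {L L' : List (Fin N)} (h : L.Perm L') :
    ∀ ψ, M.listZ L ψ = M.listZ L' ψ := by
  induction h with
  | nil => intro; rfl
  | cons v _ ih => intro ψ; simp only [listZ, ih]
  | swap u v L => intro ψ; exact listZ_swap M _ _ L ψ
  | trans _ _ ih1 ih2 => intro ψ; rw [ih1, ih2]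

theorem listZ_pos {M : MRF N q} (hq : 0 < q)
    (hf : ∀ u v, M.graph.Adj u v → ∀ x y, 0 < M.f u v x y) (L : List (Fin N)) :
    ∀ ψ : Fin N → Fin q → ℝ, (∀ v x, 0 < ψ v x) → 0 < M.listZ L ψ := by
  induction L with
  | nil => intro _ _; simp [listZ]
  | cons v L ih =>
    intro ψ hψ
    simp only [listZ]
    exact Finset.sum_pos (fun y _ => mul_pos (hψ v y) (ih _ (pin_pos hf hψ v y)))
      ⟨⟨0, hq⟩, Finset.mem_univ _⟩

/-- The partition function of the instance given by the surviving nodes `S` and the node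
potentials `ψ`. -/
noncomputable def subZ (M : MRF N q) (S : Finset (Fin N)) (ψ : Fin N → Fin q → ℝ) : ℝ :=
  M.listZ S.toList ψ

@[simp] theorem subZ_empty (M : MRF N q) (ψ : Fin N → Fin q → ℝ) : M.subZ ∅ ψ = 1 := by
  simp [subZ, listZ]

theorem subZ_pos {M : MRF N q} (hq : 0 < q)
    (hf : ∀ u v, M.graph.Adj u v → ∀ x y, 0 < M.f u v x y) (S : Finset (Fin N))
    {ψ : Fin N → Fin q → ℝ} (hψ : ∀ v x, 0 < ψ v x) : 0 < M.subZ S ψ :=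
  listZ_pos hq hf _ _ hψ

theorem subZ_congr (M : MRF N q) (S : Finset (Fin N)) {ψ ψ' : Fin N → Fin q → ℝ}
    (h : ∀ u ∈ S, ψ u = ψ' u) : M.subZ S ψ = M.subZ S ψ' :=
  listZ_congr M _ _ _ fun u hu => h u (Finset.mem_toList.1 hu)

theorem subZ_eq_sum (M : MRF N q) {S : Finset (Fin N)} {v : Fin N} (hv : v ∈ S)
    (ψ : Fin N → Fin q → ℝ) :
    M.subZ S ψ = ∑ y, ψ v y * M.subZ (S.erase v) (M.pin v y ψ) := by
  have hp : S.toList.Perm (v :: (S.erase v).toList) := by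
    conv_lhs => rw [← Finset.insert_erase hv]
    exact Finset.toList_insert (Finset.notMem_erase v S)
  rw [subZ, listZ_perm M hp]
  rfl

/-- The weight of a configuration, with the nodes treated in the order of the list. -/
noncomputable def listWeight (M : MRF N q) :
    List (Fin N) → (Fin N → Fin q → ℝ) → (Fin N → Fin q) → ℝ
  | [], _, _ => 1
  | v :: L, ψ, x => ψ v (x v) * listWeight M L (M.pin v (x v) ψ) x

theorem listWeight_congr (M : MRF N q) (L : List (Fin N)) :
    ∀ (ψ : Fin N → Fin q → ℝ) (x x' : Fin N → Fin q), (∀ u ∈ L, x u = x' u) →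
      M.listWeight L ψ x = M.listWeight L ψ x' := by
  induction L with
  | nil => intros; rfl
  | cons v L ih =>
    intro ψ x x' h
    simp only [listWeight]
    rw [h v (by simp), ih _ x x' fun u hu => h u (by simp [hu])]

/-- If `g y x` does not depend on `x v`, then summing `g (x v) x` over all `x` is, up to the
factor `q`, the same as summing over `x` and an independent letter `y`. -/
theorem card_mul_sum_eq (v : Fin N) (g : Fin q → (Fin N → Fin q) → ℝ)
    (hg : ∀ y x x', (∀ u, u ≠ v → x u = x' u) → g y x = g y x') :
    (q : ℝ) * ∑ x, g (x v) x = ∑ y, ∑ x, g y x := by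
  classical
  have h1 : ∀ F : (Fin N → Fin q) → ℝ, ∑ x, F x =
      ∑ r : {j // j ≠ v} → Fin q, ∑ y, F ((Equiv.funSplitAt v (Fin q)).symm (y, r)) := by
    intro F
    rw [← (Equiv.funSplitAt v (Fin q)).symm.sum_comp F, Fintype.sum_prod_type, Finset.sum_comm]
  have h2 : ∀ (y z : Fin q) (r : {j // j ≠ v} → Fin q),
      g y ((Equiv.funSplitAt v (Fin q)).symm (z, r)) =
        g y ((Equiv.funSplitAt v (Fin q)).symm (y, r)) := by
    intro y z r
    refine hg _ _ _ fun u hu => ?_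
    simp [Equiv.funSplitAt, Equiv.piSplitAt, hu]
  have h3 : ∀ (y : Fin q) (r : {j // j ≠ v} → Fin q),
      (Equiv.funSplitAt v (Fin q)).symm (y, r) v = y := by
    intro y r
    simp [Equiv.funSplitAt, Equiv.piSplitAt]
  rw [h1, Finset.mul_sum]
  simp_rw [h1 (g _), h2, h3]
  rw [Finset.sum_comm]
  refine Finset.sum_congr rfl fun r _ => ?_
  simp [Finset.mul_sum]

/-- The letters of the nodes outside `L` do not matter for `listWeight`, so that each of them
contributes a factor `q`; the powers of `q` are arranged so as to avoid division. -/
theorem sum_listWeight (M : MRF N q) (L : List (Fin N)) (hL : L.Nodup) :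
    ∀ ψ : Fin N → Fin q → ℝ,
      (q : ℝ) ^ L.length * ∑ x, M.listWeight L ψ x = (q : ℝ) ^ N * M.listZ L ψ := by
  induction L with
  | nil => intro ψ; simp [listWeight, listZ]
  | cons v L ih =>
    intro ψ
    have hvL : v ∉ L := (List.nodup_cons.1 hL).1
    simp only [listWeight, listZ, List.length_cons, pow_succ, mul_assoc]
    rw [card_mul_sum_eq v (fun y x => ψ v y * M.listWeight L (M.pin v y ψ) x), Finset.mul_sum,
      Finset.mul_sum]
    · refine Finset.sum_congr rfl fun y _ => ?_
      rw [← Finset.mul_sum, mul_left_comm, ih (List.nodup_cons.1 hL).2, mul_left_comm]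
    · intro y x x' h
      rw [listWeight_congr M L _ x x']
      intro u hu
      exact h u fun e => hvL (e ▸ hu)

open Classical in
theorem listWeight_eq (M : MRF N q) (x : Fin N → Fin q) (L : List (Fin N))
    (hL : L.Pairwise (· < ·)) :
    ∀ ψ : Fin N → Fin q → ℝ, M.listWeight L ψ x =
      (∏ v ∈ L.toFinset, ψ v (x v)) * ∏ v ∈ L.toFinset, ∏ u ∈ L.toFinset,
        if v < u ∧ M.graph.Adj v u then M.f v u (x v) (x u) else 1 := by
  induction L with
  | nil => intro ψ; simp [listWeight]
  | cons v L ih =>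
    intro ψ
    obtain ⟨hv, hL'⟩ := List.pairwise_cons.1 hL
    have hvL : v ∉ L.toFinset := fun h => lt_irrefl _ (hv v (List.mem_toFinset.1 h))
    simp only [listWeight, List.toFinset_cons]
    rw [ih hL', Finset.prod_insert hvL, Finset.prod_insert hvL, Finset.prod_insert hvL]
    have h1 : ∏ u ∈ L.toFinset, M.pin v (x v) ψ u (x u) = (∏ u ∈ L.toFinset, ψ u (x u)) *
        ∏ u ∈ L.toFinset, if v < u ∧ M.graph.Adj v u then M.f v u (x v) (x u) else 1 := by
      rw [← Finset.prod_mul_distrib]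
      refine Finset.prod_congr rfl fun u hu => ?_
      have := hv u (List.mem_toFinset.1 hu)
      simp only [pin, this, true_and]
      split_ifs <;> simp
    have h2 : ∏ w ∈ L.toFinset, ∏ u ∈ insert v L.toFinset,
        (if w < u ∧ M.graph.Adj w u then M.f w u (x w) (x u) else 1) =
        ∏ w ∈ L.toFinset, ∏ u ∈ L.toFinset,
        (if w < u ∧ M.graph.Adj w u then M.f w u (x w) (x u) else 1) := by
      refine Finset.prod_congr rfl fun w hw => ?_
      have := hv w (List.mem_toFinset.1 hw)
      rw [Finset.prod_insert hvL, if_neg (fun h => lt_asymm this h.1), one_mul]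
    rw [h1, h2, if_neg (fun h => lt_irrefl _ h.1)]
    ring

theorem Z_eq_subZ (M : MRF N q) (hq : 0 < q) : M.Z = M.subZ Finset.univ M.φ := by
  classical
  have h0 : M.subZ Finset.univ M.φ = M.listZ (List.finRange N) M.φ := by
    refine listZ_perm M ?_ _
    rw [List.perm_ext_iff_of_nodup (Finset.nodup_toList _) (List.nodup_finRange N)]
    simp
  have h1 := sum_listWeight M (List.finRange N) (List.nodup_finRange N) M.φ
  rw [List.length_finRange] at h1
  have hq' : (q : ℝ) ^ N ≠ 0 := by positivity
  rw [h0, ← mul_left_cancel₀ hq' h1, Z]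
  refine Finset.sum_congr rfl fun x _ => ?_
  rw [listWeight_eq M x _ (List.pairwise_lt_finRange N)]
  have : (List.finRange N).toFinset = Finset.univ := by ext; simp
  rw [this, Finset.prod_filter, Fintype.prod_prod_type]

/-! ### Marginals -/

/-- The probability of `X_v = x` in the instance given by `S` and `ψ`. -/
noncomputable def marginal (M : MRF N q) (S : Finset (Fin N)) (ψ : Fin N → Fin q → ℝ)
    (v : Fin N) (x : Fin q) : ℝ :=
  ψ v x * M.subZ (S.erase v) (M.pin v x ψ) / M.subZ S ψ

theorem marginal_pos {M : MRF N q} (hq : 0 < q)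
    (hf : ∀ u v, M.graph.Adj u v → ∀ x y, 0 < M.f u v x y) (S : Finset (Fin N))
    {ψ : Fin N → Fin q → ℝ} (hψ : ∀ v x, 0 < ψ v x) (v : Fin N) (x : Fin q) :
    0 < M.marginal S ψ v x :=
  div_pos (mul_pos (hψ v x) (subZ_pos hq hf _ (pin_pos hf hψ v x))) (subZ_pos hq hf _ hψ)

/-- Like `pin`, but only the nodes of the list `us` absorb the factor of their edge to `v`. -/
noncomputable def absorb (M : MRF N q) (v : Fin N) (x : Fin q) (us : List (Fin N))
    (ψ : Fin N → Fin q → ℝ) : Fin N → Fin q → ℝ :=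
  fun u y => if u ∈ us then ψ u y * M.f v u x y else ψ u y

/-- The chain rule for the marginals of the nodes of `us`: with the exact marginals, the iterated
sum is the expectation of the product of the edge factors between `v` and `us`. -/
theorem iterSum_marginal {M : MRF N q} (hq : 0 < q)
    (hf : ∀ u v, M.graph.Adj u v → ∀ x y, 0 < M.f u v x y) (v : Fin N) (x : Fin q)
    (us : List (Fin N)) (hus : us.Nodup) :
    ∀ (S : Finset (Fin N)) (ψ : Fin N → Fin q → ℝ), (∀ u ∈ us, u ∈ S) → (∀ v x, 0 < ψ v x) →
      M.iterSum M.marginal v x us S ψ = M.subZ S (M.absorb v x us ψ) / M.subZ S ψ := by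
  induction us with
  | nil =>
    intro S ψ _ hψ
    have : M.absorb v x [] ψ = ψ := by funext u y; simp [absorb]
    rw [this, iterSum, div_self (subZ_pos hq hf S hψ).ne']
  | cons u us ih =>
    intro S ψ hS hψ
    obtain ⟨hu, hus'⟩ := List.nodup_cons.1 hus
    rw [subZ_eq_sum M (hS u (by simp)) (M.absorb v x (u :: us) ψ), iterSum, Finset.sum_div]
    refine Finset.sum_congr rfl fun y _ => ?_
    have hsub : ∀ w ∈ us, w ∈ S.erase u := fun w hw =>
      Finset.mem_erase.2 ⟨fun e => hu (e ▸ hw), hS w (by simp [hw])⟩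
    rw [ih hus' _ _ hsub (pin_pos hf hψ u y)]
    have hc : M.subZ (S.erase u) (M.pin u y (M.absorb v x (u :: us) ψ)) =
        M.subZ (S.erase u) (M.absorb v x us (M.pin u y ψ)) := by
      refine subZ_congr M _ fun w hw => ?_
      have hwu : w ≠ u := (Finset.mem_erase.1 hw).1
      funext z
      simp only [pin, absorb, List.mem_cons, hwu, false_or]
      split_ifs <;> ring
    have hZ1 := (subZ_pos hq hf (S.erase u) (pin_pos hf hψ u y)).ne'
    have hZ2 := (subZ_pos hq hf S hψ).ne'
    rw [hc, marginal]
    simp only [absorb, List.mem_cons, true_or, if_true]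
    field_simp

theorem mem_nbrs {M : MRF N q} {S : Finset (Fin N)} {v u : Fin N} :
    u ∈ M.nbrs S v ↔ u ∈ S ∧ M.graph.Adj v u := by
  simp [nbrs]

theorem nodup_nbrs (M : MRF N q) (S : Finset (Fin N)) (v : Fin N) : (M.nbrs S v).Nodup :=
  (List.nodup_finRange N).filter _

theorem nbrs_subset_erase {M : MRF N q} {S : Finset (Fin N)} {v : Fin N} :
    ∀ u ∈ M.nbrs S v, u ∈ S.erase v := fun _ hu =>
  Finset.mem_erase.2 ⟨fun e => M.graph.irrefl (e ▸ (mem_nbrs.1 hu).2), (mem_nbrs.1 hu).1⟩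

theorem length_nbrs_le (M : MRF N q) (S : Finset (Fin N)) (v : Fin N) :
    (M.nbrs S v).length ≤ M.maxDegree := by
  classical
  have h1 : (M.nbrs S v).length = (M.nbrs S v).toFinset.card :=
    (List.toFinset_card_of_nodup (nodup_nbrs M S v)).symm
  have h2 : M.graph.degree v ≤ M.maxDegree := by
    unfold maxDegree
    convert M.graph.degree_le_maxDegree v
  rw [h1]
  refine le_trans (Finset.card_le_card ?_) h2
  intro u hu
  rw [SimpleGraph.mem_neighborFinset]
  exact (mem_nbrs.1 (List.mem_toFinset.1 hu)).2

/-- The exact marginals satisfy the recursion that defines `Phi`. -/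
theorem marginal_eq {M : MRF N q} (hq : 0 < q)
    (hf : ∀ u v, M.graph.Adj u v → ∀ x y, 0 < M.f u v x y) {S : Finset (Fin N)}
    {ψ : Fin N → Fin q → ℝ} (hψ : ∀ v x, 0 < ψ v x) {v : Fin N} (hv : v ∈ S) (x₀ : Fin q) :
    M.marginal S ψ v x₀ =
      ψ v x₀ * M.iterSum M.marginal v x₀ (M.nbrs S v) (S.erase v) ψ /
        ∑ x, ψ v x * M.iterSum M.marginal v x (M.nbrs S v) (S.erase v) ψ := by
  have h : ∀ x, M.iterSum M.marginal v x (M.nbrs S v) (S.erase v) ψ =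
      M.subZ (S.erase v) (M.pin v x ψ) / M.subZ (S.erase v) ψ := by
    intro x
    rw [iterSum_marginal hq hf v x _ (nodup_nbrs M S v) _ _ nbrs_subset_erase hψ]
    congr 1
    refine subZ_congr M _ fun u hu => ?_
    funext y
    have hn : u ∈ M.nbrs S v ↔ M.graph.Adj v u := by
      rw [mem_nbrs, and_iff_right (Finset.mem_erase.1 hu).2]
    by_cases h : M.graph.Adj v u
    · rw [absorb, pin, if_pos (hn.2 h), if_pos h]
    · rw [absorb, pin, if_neg (hn.not.2 h), if_neg h]
  have hZ := (subZ_pos hq hf (S.erase v) hψ).ne'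
  simp only [h, marginal, ← mul_div_assoc]
  rw [← Finset.sum_div, ← subZ_eq_sum M hv]
  rw [div_div_div_cancel_right₀ hZ]

end MRF

namespace MRF

variable {N q : ℕ}

/-! ### Contraction of the recursion -/

/-- If the tilts `T` and `T'` are within a factor `K` of each other and the weights `w` and `w'`
within a factor `G`, then replacing `w` by `w'` changes the ratio of the two tilted sums by a
factor of at most `1 + (K² - 1) / (K² + 1) * (G² - 1)`. -/
theorem sum_mul_sum_le_of_ratio {ι : Type*} [Fintype ι] {T T' w w' : ι → ℝ} {K G : ℝ}
    (hT : ∀ i, 0 < T i) (hT' : ∀ i, 0 < T' i) (hw : ∀ i, 0 < w i) (hw' : ∀ i, 0 < w' i)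
    (hK : 1 ≤ K) (hG : 1 ≤ G) (hTT : ∀ i, T i ≤ K * T' i) (hTT' : ∀ i, T' i ≤ K * T i)
    (hww : ∀ i, w i ≤ G * w' i) (hww' : ∀ i, w' i ≤ G * w i) :
    (∑ i, T i * w i) * (∑ i, T' i * w' i) ≤
      (1 + (K ^ 2 - 1) / (K ^ 2 + 1) * (G ^ 2 - 1)) *
        ((∑ i, T i * w' i) * (∑ i, T' i * w i)) := by
  set τ := (K ^ 2 - 1) / (K ^ 2 + 1) with hτ
  have hK2 : (1 : ℝ) ≤ K ^ 2 := one_le_pow₀ hK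
  have hG2 : (1 : ℝ) ≤ G ^ 2 := one_le_pow₀ hG
  have hτ0 : 0 ≤ τ := div_nonneg (by linarith) (by linarith)
  -- a ratio in `[K⁻², K²]` bounds the difference of two numbers by `τ` times their sum
  have key1 : ∀ a b : ℝ, a ≤ K ^ 2 * b → a - b ≤ τ * (a + b) := by
    intro a b h
    rw [hτ, div_mul_eq_mul_div, le_div_iff₀ (by linarith)]
    nlinarith
  have key2 : ∀ a b : ℝ, 0 < a → 0 < b → a ≤ K ^ 2 * b → b ≤ K ^ 2 * a →
      |a - b| ≤ τ * (a + b) := by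
    intro a b _ _ h1 h2
    rw [abs_le]
    constructor
    · linarith [key1 b a h2]
    · exact key1 a b h1
  have key3 : ∀ a b : ℝ, a ≤ G ^ 2 * b → b ≤ G ^ 2 * a → 0 < a → 0 < b →
      |a - b| ≤ (G ^ 2 - 1) * a ∧ |a - b| ≤ (G ^ 2 - 1) * b := by
    intro a b h1 h2 ha hb
    constructor <;> rw [abs_le] <;> constructor <;> nlinarith
  -- the pairwise form of the claim, summed over `i` and `j` and symmetrized
  have pair : ∀ i j, (T i * T' j - T j * T' i) * (w i * w' j - w j * w' i) ≤
      τ * (G ^ 2 - 1) * (T i * T' j * (w j * w' i) + T j * T' i * (w i * w' j)) := by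
    intro i j
    have a1 : |T i * T' j - T j * T' i| ≤ τ * (T i * T' j + T j * T' i) := by
      refine key2 _ _ (mul_pos (hT i) (hT' j)) (mul_pos (hT j) (hT' i)) ?_ ?_
      · calc T i * T' j ≤ (K * T' i) * (K * T j) :=
              mul_le_mul (hTT i) (hTT' j) (hT' j).le (by nlinarith [hT' i])
          _ = _ := by ring
      · calc T j * T' i ≤ (K * T' j) * (K * T i) :=
              mul_le_mul (hTT j) (hTT' i) (hT' i).le (by nlinarith [hT' j])
          _ = _ := by ring
    obtain ⟨b1, b2⟩ := key3 (w i * w' j) (w j * w' i) (by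
        calc w i * w' j ≤ (G * w' i) * (G * w j) :=
              mul_le_mul (hww i) (hww' j) (hw' j).le (by nlinarith [hw' i])
          _ = _ := by ring) (by
        calc w j * w' i ≤ (G * w' j) * (G * w i) :=
              mul_le_mul (hww j) (hww' i) (hw' i).le (by nlinarith [hw' j])
          _ = _ := by ring) (mul_pos (hw i) (hw' j)) (mul_pos (hw j) (hw' i))
    have p1 := mul_pos (hT i) (hT' j)
    have p2 := mul_pos (hT j) (hT' i)
    calc (T i * T' j - T j * T' i) * (w i * w' j - w j * w' i)
        ≤ |T i * T' j - T j * T' i| * |w i * w' j - w j * w' i| := by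
          rw [← abs_mul]; exact le_abs_self _
      _ ≤ τ * (T i * T' j + T j * T' i) * |w i * w' j - w j * w' i| :=
          mul_le_mul_of_nonneg_right a1 (abs_nonneg _)
      _ = τ * (T i * T' j * |w i * w' j - w j * w' i| +
            T j * T' i * |w i * w' j - w j * w' i|) := by ring
      _ ≤ τ * (T i * T' j * ((G ^ 2 - 1) * (w j * w' i)) +
            T j * T' i * ((G ^ 2 - 1) * (w i * w' j))) := by gcongr
      _ = _ := by ring
  have hsum := Finset.sum_le_sum fun i (_ : i ∈ Finset.univ) =>
    Finset.sum_le_sum fun j (_ : j ∈ Finset.univ) => pair i j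
  have e1 : ∑ i, ∑ j, (T i * T' j - T j * T' i) * (w i * w' j - w j * w' i) =
      2 * ((∑ i, T i * w i) * (∑ i, T' i * w' i) - (∑ i, T i * w' i) * (∑ i, T' i * w i)) := by
    have : ∀ i j, (T i * T' j - T j * T' i) * (w i * w' j - w j * w' i) =
        (T i * w i) * (T' j * w' j) - (T i * w' i) * (T' j * w j) -
          (T' i * w i) * (T j * w' j) + (T' i * w' i) * (T j * w j) := fun i j => by ring
    simp_rw [this, Finset.sum_add_distrib, Finset.sum_sub_distrib, ← Finset.sum_mul_sum]
    ring
  have e2 : ∑ i, ∑ j, τ * (G ^ 2 - 1) *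
        (T i * T' j * (w j * w' i) + T j * T' i * (w i * w' j)) =
      2 * (τ * (G ^ 2 - 1) * ((∑ i, T i * w' i) * (∑ i, T' i * w i))) := by
    have : ∀ i j, τ * (G ^ 2 - 1) * (T i * T' j * (w j * w' i) + T j * T' i * (w i * w' j)) =
        τ * (G ^ 2 - 1) * ((T i * w' i) * (T' j * w j) + (T' i * w i) * (T j * w' j)) :=
      fun i j => by ring
    simp_rw [this, ← Finset.mul_sum, Finset.sum_add_distrib, ← Finset.sum_mul_sum]
    ring
  rw [e1, e2] at hsum
  linarith

/-- The iterated sums for two surrogates `Ψ` and `Ψ'`, which agree up to a factor `G`, written as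
sums over one index set: the first letter `x` enters only through the tilt `T x`, the surrogates
only through the weights `w` and `w'`. -/
theorem exists_iterSum_eq {M : MRF N q}
    (hf : ∀ u v, M.graph.Adj u v → ∀ x y, 0 < M.f u v x y) {c G : ℝ} (hc : 0 ≤ c) (hG : 0 ≤ G)
    (hcf : ∀ u v, M.graph.Adj u v → ∀ x x' y, M.f u v x y ≤ c * M.f u v x' y)
    {Ψ Ψ' : Finset (Fin N) → (Fin N → Fin q → ℝ) → Fin N → Fin q → ℝ}
    (hΨ : ∀ S ψ v x, (∀ v x, 0 < ψ v x) → v ∈ S →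
      0 < Ψ S ψ v x ∧ 0 < Ψ' S ψ v x ∧ Ψ S ψ v x ≤ G * Ψ' S ψ v x ∧ Ψ' S ψ v x ≤ G * Ψ S ψ v x)
    (v : Fin N) (us : List (Fin N)) (hus : us.Nodup) (hadj : ∀ u ∈ us, M.graph.Adj v u) :
    ∀ (S : Finset (Fin N)) (ψ : Fin N → Fin q → ℝ), (∀ u ∈ us, u ∈ S) → (∀ v x, 0 < ψ v x) →
      ∃ (ι : Type) (_ : Fintype ι) (T : Fin q → ι → ℝ) (w w' : ι → ℝ),
        (∀ x, M.iterSum Ψ v x us S ψ = ∑ i, T x i * w i) ∧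
        (∀ x, M.iterSum Ψ' v x us S ψ = ∑ i, T x i * w' i) ∧
        (∀ x i, 0 < T x i) ∧ (∀ i, 0 < w i) ∧ (∀ i, 0 < w' i) ∧
        (∀ x x' i, T x i ≤ c ^ us.length * T x' i) ∧
        (∀ i, w i ≤ G ^ us.length * w' i) ∧ (∀ i, w' i ≤ G ^ us.length * w i) := by
  induction us with
  | nil =>
    intro S ψ _ _
    exact ⟨Unit, inferInstance, fun _ _ => 1, fun _ => 1, fun _ => 1, by simp [iterSum]⟩
  | cons u us ih =>
    intro S ψ hS hψ
    obtain ⟨hu, hus'⟩ := List.nodup_cons.1 hus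
    have hsub : ∀ w ∈ us, w ∈ S.erase u := fun w hw =>
      Finset.mem_erase.2 ⟨fun e => hu (e ▸ hw), hS w (by simp [hw])⟩
    have hvu := hadj u (by simp)
    have H := fun y => ih hus' (fun w hw => hadj w (by simp [hw])) (S.erase u) (M.pin u y ψ) hsub
      (pin_pos hf hψ u y)
    choose ι fι T w w' h1 h2 hT hw hw' hTT hww hww' using H
    have hP := fun y => hΨ S ψ u y hψ (hS u (by simp))
    refine ⟨Σ y, ι y, inferInstance, fun x i => M.f v u x i.1 * T i.1 x i.2,
      fun i => Ψ S ψ u i.1 * w i.1 i.2, fun i => Ψ' S ψ u i.1 * w' i.1 i.2,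
      ?_, ?_, ?_, ?_, ?_, ?_, ?_, ?_⟩
    · intro x
      rw [Fintype.sum_sigma, iterSum]
      refine Finset.sum_congr rfl fun y _ => ?_
      rw [h1, Finset.mul_sum]
      exact Finset.sum_congr rfl fun i _ => by ring
    · intro x
      rw [Fintype.sum_sigma, iterSum]
      refine Finset.sum_congr rfl fun y _ => ?_
      rw [h2, Finset.mul_sum]
      exact Finset.sum_congr rfl fun i _ => by ring
    · exact fun x i => mul_pos (hf v u hvu _ _) (hT _ _ _)
    · exact fun i => mul_pos (hP _).1 (hw _ _)
    · exact fun i => mul_pos (hP _).2.1 (hw' _ _)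
    · intro x x' i
      calc M.f v u x i.1 * T i.1 x i.2
          ≤ (c * M.f v u x' i.1) * (c ^ us.length * T i.1 x' i.2) :=
            mul_le_mul (hcf v u hvu _ _ _) (hTT _ _ _ _) (hT _ _ _).le
              (mul_nonneg hc (hf v u hvu _ _).le)
        _ = _ := by rw [List.length_cons]; ring
    · intro i
      calc Ψ S ψ u i.1 * w i.1 i.2 ≤ (G * Ψ' S ψ u i.1) * (G ^ us.length * w' i.1 i.2) :=
            mul_le_mul (hP _).2.2.1 (hww _ _) (hw _ _).le (mul_nonneg hG (hP _).2.1.le)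
        _ = _ := by rw [List.length_cons]; ring
    · intro i
      calc Ψ' S ψ u i.1 * w' i.1 i.2 ≤ (G * Ψ S ψ u i.1) * (G ^ us.length * w i.1 i.2) :=
            mul_le_mul (hP _).2.2.2 (hww' _ _) (hw' _ _).le (mul_nonneg hG (hP _).1.le)
        _ = _ := by rw [List.length_cons]; ring

theorem iterSum_pos {M : MRF N q} (hq : 0 < q)
    (hf : ∀ u v, M.graph.Adj u v → ∀ x y, 0 < M.f u v x y)
    {Ψ : Finset (Fin N) → (Fin N → Fin q → ℝ) → Fin N → Fin q → ℝ}
    (hΨ : ∀ S ψ v x, (∀ v x, 0 < ψ v x) → 0 < Ψ S ψ v x)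
    (v : Fin N) (x : Fin q) (us : List (Fin N)) (hadj : ∀ u ∈ us, M.graph.Adj v u) :
    ∀ (S : Finset (Fin N)) (ψ : Fin N → Fin q → ℝ), (∀ v x, 0 < ψ v x) →
      0 < M.iterSum Ψ v x us S ψ := by
  induction us with
  | nil => intro _ _ _; simp [iterSum]
  | cons u us ih =>
    intro S ψ hψ
    rw [iterSum]
    refine Finset.sum_pos (fun y _ => mul_pos (mul_pos (hf v u (hadj u (by simp)) _ _)
      (hΨ _ _ _ _ hψ)) (ih (fun w hw => hadj w (by simp [hw])) _ _ (pin_pos hf hψ u y)))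
      ⟨⟨0, hq⟩, Finset.mem_univ _⟩

theorem sum_iterSum_pos {M : MRF N q} (hq : 0 < q)
    (hf : ∀ u v, M.graph.Adj u v → ∀ x y, 0 < M.f u v x y)
    {Ψ : Finset (Fin N) → (Fin N → Fin q → ℝ) → Fin N → Fin q → ℝ}
    (hΨ : ∀ S ψ v x, (∀ v x, 0 < ψ v x) → 0 < Ψ S ψ v x)
    (S : Finset (Fin N)) {ψ : Fin N → Fin q → ℝ} (hψ : ∀ v x, 0 < ψ v x) (v : Fin N) :
    0 < ∑ x, ψ v x * M.iterSum Ψ v x (M.nbrs S v) (S.erase v) ψ :=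
  Finset.sum_pos (fun x _ => mul_pos (hψ v x)
    (iterSum_pos hq hf hΨ v x _ (fun _ hu => (mem_nbrs.1 hu).2) _ _ hψ))
    ⟨⟨0, hq⟩, Finset.mem_univ _⟩

theorem Phi_pos {M : MRF N q} (hq : 0 < q)
    (hf : ∀ u v, M.graph.Adj u v → ∀ x y, 0 < M.f u v x y) (d : ℕ) :
    ∀ S ψ v x, (∀ v x, 0 < ψ v x) → 0 < M.Phi d S ψ v x := by
  induction d with
  | zero => intro _ _ _ _ _; simp [Phi]
  | succ d ih =>
    intro S ψ v x hψ
    rw [Phi]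
    exact div_pos (mul_pos (hψ v x) (iterSum_pos hq hf ih v x _
      (fun _ hu => (mem_nbrs.1 hu).2) _ _ hψ)) (sum_iterSum_pos hq hf ih S hψ v)

/-- Normalizing `g * a` and `g * b` to probability vectors changes their ratio at `i₀` by at most
the largest ratio of `a i₀ / b i₀` and `a i / b i`. -/
theorem div_sum_le_of_ratio {ι : Type*} [Fintype ι] {g a b : ι → ℝ} (hg : ∀ i, 0 < g i)
    {ρ : ℝ} (ha : 0 < ∑ i, g i * a i) (hb : 0 < ∑ i, g i * b i) (i₀ : ι)
    (h : ∀ i, a i₀ * b i ≤ ρ * (b i₀ * a i)) :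
    g i₀ * a i₀ / ∑ i, g i * a i ≤ ρ * (g i₀ * b i₀ / ∑ i, g i * b i) := by
  rw [← mul_div_assoc, div_le_div_iff₀ ha hb, Finset.mul_sum, Finset.mul_sum]
  refine Finset.sum_le_sum fun i _ => ?_
  have := mul_le_mul_of_nonneg_left (h i) (mul_pos (hg i₀) (hg i)).le
  linarith

/-- `Ψ` and `Ψ'` agree up to the factor `ρ` at the surviving nodes of instances with positive node
potentials. -/
def Within (ρ : ℝ) (Ψ Ψ' : Finset (Fin N) → (Fin N → Fin q → ℝ) → Fin N → Fin q → ℝ) : Prop :=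
  ∀ S ψ v x, (∀ v x, 0 < ψ v x) → v ∈ S →
    Ψ S ψ v x ≤ ρ * Ψ' S ψ v x ∧ Ψ' S ψ v x ≤ ρ * Ψ S ψ v x

/-- Passing from one surrogate to another, the ratio `A x / A x'` changes by less than the surrogates
do: this is where the error contracts. -/
theorem iterSum_ratio_le {M : MRF N q}
    (hf : ∀ u v, M.graph.Adj u v → ∀ x y, 0 < M.f u v x y) {c G : ℝ} (hc : 1 ≤ c) (hG : 1 ≤ G)
    (hcf : ∀ u v, M.graph.Adj u v → ∀ x x' y, M.f u v x y ≤ c * M.f u v x' y)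
    {Ψ Ψ' : Finset (Fin N) → (Fin N → Fin q → ℝ) → Fin N → Fin q → ℝ}
    (hΨ : ∀ S ψ v x, (∀ v x, 0 < ψ v x) → 0 < Ψ S ψ v x)
    (hΨ' : ∀ S ψ v x, (∀ v x, 0 < ψ v x) → 0 < Ψ' S ψ v x) (hW : Within G Ψ Ψ')
    (S : Finset (Fin N)) {ψ : Fin N → Fin q → ℝ} (hψ : ∀ v x, 0 < ψ v x) (v : Fin N)
    (x x' : Fin q) {K : ℝ} (hK : K = c ^ M.maxDegree) :
    M.iterSum Ψ v x (M.nbrs S v) (S.erase v) ψ * M.iterSum Ψ' v x' (M.nbrs S v) (S.erase v) ψ ≤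
      (1 + (K ^ 2 - 1) / (K ^ 2 + 1) * ((G ^ M.maxDegree) ^ 2 - 1)) *
      (M.iterSum Ψ' v x (M.nbrs S v) (S.erase v) ψ *
        M.iterSum Ψ v x' (M.nbrs S v) (S.erase v) ψ) := by
  obtain ⟨ι, _, T, w, w', h1, h2, hT, hw, hw', hTT, hww, hww'⟩ :=
    exists_iterSum_eq hf (zero_le_one.trans hc) (zero_le_one.trans hG) hcf
      (fun S ψ v x hψ hv => ⟨hΨ S ψ v x hψ, hΨ' S ψ v x hψ, hW S ψ v x hψ hv⟩) v (M.nbrs S v)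
      (nodup_nbrs M S v) (fun u hu => (mem_nbrs.1 hu).2) (S.erase v) ψ nbrs_subset_erase hψ
  have hlen := length_nbrs_le M S v
  have hcK : c ^ (M.nbrs S v).length ≤ K := hK ▸ pow_le_pow_right₀ hc hlen
  have hGK : G ^ (M.nbrs S v).length ≤ G ^ M.maxDegree := pow_le_pow_right₀ hG hlen
  have hK1 : 1 ≤ K := hK ▸ one_le_pow₀ hc
  rw [h1, h1, h2, h2]
  exact sum_mul_sum_le_of_ratio (hT x) (hT x') hw hw' hK1 (one_le_pow₀ hG)
    (fun i => (hTT x x' i).trans (mul_le_mul_of_nonneg_right hcK (hT x' i).le))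
    (fun i => (hTT x' x i).trans (mul_le_mul_of_nonneg_right hcK (hT x i).le))
    (fun i => (hww i).trans (mul_le_mul_of_nonneg_right hGK (hw' i).le))
    (fun i => (hww' i).trans (mul_le_mul_of_nonneg_right hGK (hw i).le))

/-- Whatever the surrogates are, `A x / A x'` is determined up to a factor `K²`. -/
theorem iterSum_ratio_le_sq {M : MRF N q}
    (hf : ∀ u v, M.graph.Adj u v → ∀ x y, 0 < M.f u v x y) {c : ℝ} (hc : 1 ≤ c)
    (hcf : ∀ u v, M.graph.Adj u v → ∀ x x' y, M.f u v x y ≤ c * M.f u v x' y)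
    {Ψ Ψ' : Finset (Fin N) → (Fin N → Fin q → ℝ) → Fin N → Fin q → ℝ}
    (hΨ : ∀ S ψ v x, (∀ v x, 0 < ψ v x) → 0 < Ψ S ψ v x)
    (hΨ' : ∀ S ψ v x, (∀ v x, 0 < ψ v x) → 0 < Ψ' S ψ v x)
    (S : Finset (Fin N)) {ψ : Fin N → Fin q → ℝ} (hψ : ∀ v x, 0 < ψ v x) (v : Fin N)
    (x x' : Fin q) {K : ℝ} (hK : K = c ^ M.maxDegree) :
    M.iterSum Ψ v x (M.nbrs S v) (S.erase v) ψ * M.iterSum Ψ' v x' (M.nbrs S v) (S.erase v) ψ ≤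
      K ^ 2 * (M.iterSum Ψ' v x (M.nbrs S v) (S.erase v) ψ *
        M.iterSum Ψ v x' (M.nbrs S v) (S.erase v) ψ) := by
  have hlen := length_nbrs_le M S v
  have hcK : c ^ (M.nbrs S v).length ≤ K := hK ▸ pow_le_pow_right₀ hc hlen
  have hK1 : 1 ≤ K := hK ▸ one_le_pow₀ hc
  have key : ∀ (Ψ : Finset (Fin N) → (Fin N → Fin q → ℝ) → Fin N → Fin q → ℝ) (x x' : Fin q),
      (∀ S ψ v x, (∀ v x, 0 < ψ v x) → 0 < Ψ S ψ v x) →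
      0 ≤ M.iterSum Ψ v x (M.nbrs S v) (S.erase v) ψ ∧
      M.iterSum Ψ v x (M.nbrs S v) (S.erase v) ψ ≤
        K * M.iterSum Ψ v x' (M.nbrs S v) (S.erase v) ψ := by
    intro Ψ x x' hΨ
    obtain ⟨ι, _, T, w, -, h1, -, hT, hw, -, hTT, -, -⟩ :=
      exists_iterSum_eq (Ψ := Ψ) (Ψ' := Ψ) (G := 1) hf (zero_le_one.trans hc) zero_le_one hcf
        (fun S ψ v x hψ hv => ⟨hΨ S ψ v x hψ, hΨ S ψ v x hψ, by simp, by simp⟩) v (M.nbrs S v)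
        (nodup_nbrs M S v) (fun u hu => (mem_nbrs.1 hu).2) (S.erase v) ψ nbrs_subset_erase hψ
    rw [h1, h1, Finset.mul_sum]
    refine ⟨Finset.sum_nonneg fun i _ => (mul_pos (hT x i) (hw i)).le,
      Finset.sum_le_sum fun i _ => ?_⟩
    rw [← mul_assoc]
    exact mul_le_mul_of_nonneg_right ((hTT x x' i).trans
      (mul_le_mul_of_nonneg_right hcK (hT x' i).le)) (hw i).le
  have k1 := key Ψ x x' hΨ
  have k2 := key Ψ' x' x hΨ'
  calc _ ≤ (K * M.iterSum Ψ v x' (M.nbrs S v) (S.erase v) ψ) *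
        (K * M.iterSum Ψ' v x (M.nbrs S v) (S.erase v) ψ) :=
        mul_le_mul k1.2 k2.2 k2.1 (k1.1.trans k1.2)
    _ = _ := by ring

/-- A bound for the ratios of `A` gives the same bound for the next level of the recursion. -/
theorem within_Phi_succ {M : MRF N q} (hq : 0 < q)
    (hf : ∀ u v, M.graph.Adj u v → ∀ x y, 0 < M.f u v x y) {d : ℕ} {ρ : ℝ} (hρ : 1 ≤ ρ)
    (h : ∀ Ψ Ψ', (Ψ = M.marginal ∧ Ψ' = M.Phi d) ∨ (Ψ = M.Phi d ∧ Ψ' = M.marginal) →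
      ∀ (S : Finset (Fin N)) (ψ : Fin N → Fin q → ℝ), (∀ v x, 0 < ψ v x) → ∀ v x x', x ≠ x' →
      M.iterSum Ψ v x (M.nbrs S v) (S.erase v) ψ *
        M.iterSum Ψ' v x' (M.nbrs S v) (S.erase v) ψ ≤
      ρ * (M.iterSum Ψ' v x (M.nbrs S v) (S.erase v) ψ *
        M.iterSum Ψ v x' (M.nbrs S v) (S.erase v) ψ)) :
    Within ρ M.marginal (M.Phi (d + 1)) := by
  intro S ψ v x hψ hv
  have hm : ∀ S ψ v x, (∀ v x, 0 < ψ v x) → 0 < M.marginal S ψ v x :=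
    fun S ψ v x hψ => marginal_pos hq hf S hψ v x
  have hP := Phi_pos (M := M) hq hf d
  have hadj : ∀ u ∈ M.nbrs S v, M.graph.Adj v u := fun _ hu => (mem_nbrs.1 hu).2
  rw [marginal_eq hq hf hψ hv, Phi]
  constructor
  · refine div_sum_le_of_ratio (hψ v) (sum_iterSum_pos hq hf hm S hψ v)
      (sum_iterSum_pos hq hf hP S hψ v) x fun x' => ?_
    by_cases hx : x = x'
    · subst hx
      rw [mul_comm]
      exact le_mul_of_one_le_left (mul_pos (iterSum_pos hq hf hP v x _ hadj _ _ hψ)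
        (iterSum_pos hq hf hm v x _ hadj _ _ hψ)).le hρ
    · exact h _ _ (Or.inl ⟨rfl, rfl⟩) S ψ hψ v x x' hx
  · refine div_sum_le_of_ratio (hψ v) (sum_iterSum_pos hq hf hP S hψ v)
      (sum_iterSum_pos hq hf hm S hψ v) x fun x' => ?_
    by_cases hx : x = x'
    · subst hx
      rw [mul_comm]
      exact le_mul_of_one_le_left (mul_pos (iterSum_pos hq hf hm v x _ hadj _ _ hψ)
        (iterSum_pos hq hf hP v x _ hadj _ _ hψ)).le hρ
    · exact h _ _ (Or.inr ⟨rfl, rfl⟩) S ψ hψ v x x' hx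

theorem Within.symm {ρ : ℝ} {Ψ Ψ' : Finset (Fin N) → (Fin N → Fin q → ℝ) → Fin N → Fin q → ℝ}
    (h : Within ρ Ψ Ψ') : Within ρ Ψ' Ψ := fun S ψ v x hψ hv => (h S ψ v x hψ hv).symm

/-- The numerical contraction: the error factor `exp ε` at the children gives `exp (7/8 ε)`. -/
theorem ratio_bound_le_exp {K ε : ℝ} {D : ℕ} (hK : 1 ≤ K) (hε : 0 ≤ ε)
    (hεK : ε ≤ K - K⁻¹) (hD : D * (K - K⁻¹) ≤ 1 / 2) :
    1 + (K ^ 2 - 1) / (K ^ 2 + 1) * ((Real.exp ε ^ D) ^ 2 - 1) ≤ Real.exp (7 / 8 * ε) := by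
  have hK0 : 0 < K := by linarith
  have ht : 0 ≤ K - K⁻¹ := by linarith
  have hτ0 : 0 ≤ (K ^ 2 - 1) / (K ^ 2 + 1) := div_nonneg (by nlinarith) (by positivity)
  have hτ : (K ^ 2 - 1) / (K ^ 2 + 1) ≤ (K - K⁻¹) / 2 := by
    have : (K - K⁻¹) / 2 = (K ^ 2 - 1) / (2 * K) := by field_simp
    rw [this]
    exact div_le_div_of_nonneg_left (by nlinarith) (by linarith) (by nlinarith [sq_nonneg (K - 1)])
  have hD0 : (0 : ℝ) ≤ D := Nat.cast_nonneg D
  set s : ℝ := 2 * (D * ε) with hs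
  have hs0 : 0 ≤ s := by positivity
  have hs1 : s ≤ 1 := by nlinarith
  have e : (Real.exp ε ^ D) ^ 2 = Real.exp s := by
    rw [← Real.exp_nat_mul, ← Real.exp_nat_mul, hs]; norm_num
  have hexp : Real.exp s - 1 ≤ 7 / 4 * s := by
    have := Real.exp_bound' hs0 hs1 (n := 2) (by norm_num)
    norm_num [Finset.sum_range_succ, Nat.factorial] at this
    nlinarith
  rw [e]
  calc 1 + (K ^ 2 - 1) / (K ^ 2 + 1) * (Real.exp s - 1)
      ≤ 1 + (K - K⁻¹) / 2 * (7 / 4 * s) := by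
        have : (K ^ 2 - 1) / (K ^ 2 + 1) * (Real.exp s - 1) ≤ (K - K⁻¹) / 2 * (7 / 4 * s) :=
          mul_le_mul hτ hexp (by linarith [Real.add_one_le_exp s]) (by linarith)
        linarith
    _ = 7 / 4 * (D * (K - K⁻¹)) * ε + 1 := by rw [hs]; ring
    _ ≤ 7 / 8 * ε + 1 := by nlinarith
    _ ≤ _ := Real.add_one_le_exp _

/-- Correlation decay: at depth `d + 1`, the surrogate agrees with the marginal up to the factor
`exp ((7/8)ᵈ (K - K⁻¹))`. -/
theorem within_marginal_Phi {M : MRF N q} (hq : 0 < q)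
    (hf : ∀ u v, M.graph.Adj u v → ∀ x y, 0 < M.f u v x y) {c K : ℝ} (hc : 1 ≤ c)
    (hcf : ∀ u v, M.graph.Adj u v → ∀ x x' y, M.f u v x y ≤ c * M.f u v x' y)
    (hK : K = c ^ M.maxDegree) (hγ : (K - K⁻¹) * M.maxDegree * (q : ℝ) ^ M.maxDegree < 1)
    (d : ℕ) :
    Within (Real.exp ((7 / 8) ^ d * (K - K⁻¹))) M.marginal (M.Phi (d + 1)) := by
  have hK1 : 1 ≤ K := hK ▸ one_le_pow₀ hc
  have hK0 : 0 < K := by linarith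
  have ht : 0 ≤ K - K⁻¹ := by linarith [inv_le_one_of_one_le₀ hK1]
  have hm : ∀ S ψ v x, (∀ v x, 0 < ψ v x) → 0 < M.marginal S ψ v x :=
    fun S ψ v x hψ => marginal_pos hq hf S hψ v x
  induction d with
  | zero =>
    rw [pow_zero, one_mul]
    have hKexp : K ^ 2 ≤ Real.exp (K - K⁻¹) := by
      have h1 : Real.log K ≤ Real.sinh (Real.log K) :=
        Real.self_le_sinh_iff.2 (Real.log_nonneg hK1)
      rw [Real.sinh_log hK0] at h1
      calc K ^ 2 = Real.exp (2 * Real.log K) := by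
            rw [two_mul, Real.exp_add, Real.exp_log hK0]; ring
        _ ≤ _ := Real.exp_le_exp.2 (by linarith)
    refine within_Phi_succ hq hf (Real.one_le_exp ht) ?_
    intro Ψ Ψ' hΨ S ψ hψ v x x' _
    have hP := Phi_pos (M := M) hq hf 0
    have hp : (∀ S ψ v x, (∀ v x, 0 < ψ v x) → 0 < Ψ S ψ v x) ∧
        (∀ S ψ v x, (∀ v x, 0 < ψ v x) → 0 < Ψ' S ψ v x) := by
      rcases hΨ with ⟨rfl, rfl⟩ | ⟨rfl, rfl⟩
      exacts [⟨hm, hP⟩, ⟨hP, hm⟩]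
    refine (iterSum_ratio_le_sq hf hc hcf hp.1 hp.2 S hψ v x x' hK).trans ?_
    refine mul_le_mul_of_nonneg_right hKexp (mul_pos ?_ ?_).le
    · exact iterSum_pos hq hf hp.2 v x _ (fun _ hu => (mem_nbrs.1 hu).2) _ _ hψ
    · exact iterSum_pos hq hf hp.1 v x' _ (fun _ hu => (mem_nbrs.1 hu).2) _ _ hψ
  | succ d ih =>
    have hε : 0 ≤ (7 / 8 : ℝ) ^ d * (K - K⁻¹) := by positivity
    have e : (7 / 8 : ℝ) ^ (d + 1) * (K - K⁻¹) = 7 / 8 * ((7 / 8 : ℝ) ^ d * (K - K⁻¹)) := by ring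
    rw [e]
    refine within_Phi_succ hq hf (Real.one_le_exp (by positivity)) ?_
    intro Ψ Ψ' hΨ S ψ hψ v x x' hx
    have hP := Phi_pos (M := M) hq hf (d + 1)
    have hp : (∀ S ψ v x, (∀ v x, 0 < ψ v x) → 0 < Ψ S ψ v x) ∧
        (∀ S ψ v x, (∀ v x, 0 < ψ v x) → 0 < Ψ' S ψ v x) ∧
        Within (Real.exp ((7 / 8) ^ d * (K - K⁻¹))) Ψ Ψ' := by
      rcases hΨ with ⟨rfl, rfl⟩ | ⟨rfl, rfl⟩
      exacts [⟨hm, hP, ih⟩, ⟨hP, hm, ih.symm⟩]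
    refine (iterSum_ratio_le hf hc (Real.one_le_exp hε) hcf hp.1 hp.2.1 hp.2.2 S hψ v x x'
      hK).trans ?_
    refine mul_le_mul_of_nonneg_right (ratio_bound_le_exp hK1 hε ?_ ?_) (mul_pos ?_ ?_).le
    · exact mul_le_of_le_one_left ht (pow_le_one₀ (by norm_num) (by norm_num))
    · -- there are two letters, so that `q ^ Δ ≥ 2` unless `Δ = 0`
      have hq2 : 2 ≤ q := by
        by_contra hlt
        exact hx (Fin.ext (by omega))
      rcases Nat.eq_zero_or_pos M.maxDegree with h0 | h0
      · rw [h0]; norm_num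
      · have h2 : (2 : ℝ) ≤ (q : ℝ) ^ M.maxDegree := by
          calc (2 : ℝ) ≤ (q : ℝ) := by exact_mod_cast hq2
            _ ≤ _ := le_self_pow₀ (by exact_mod_cast hq) h0.ne'
        have h3 : 0 ≤ (K - K⁻¹) * M.maxDegree := by positivity
        nlinarith
    · exact iterSum_pos hq hf hp.2.1 v x _ (fun _ hu => (mem_nbrs.1 hu).2) _ _ hψ
    · exact iterSum_pos hq hf hp.1 v x' _ (fun _ hu => (mem_nbrs.1 hu).2) _ _ hψ

/-! ### The accuracy of ComputeZ -/

/-- ComputeZ and the exact partition function telescope in the same way, with the surrogate in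
place of the marginal, so that each round costs one factor `ρ`. -/
theorem computeZAux_bounds {M : MRF N q} (hq : 0 < q)
    (hf : ∀ u v, M.graph.Adj u v → ∀ x y, 0 < M.f u v x y) {d : ℕ} {ρ : ℝ} (hρ : 0 < ρ)
    (hW : Within ρ M.marginal (M.Phi d)) (L : List (Fin N × Fin q)) :
    ∀ (S : Finset (Fin N)) (ψ : Fin N → Fin q → ℝ), (L.map Prod.fst).Nodup →
      (∀ u, u ∈ S ↔ u ∈ L.map Prod.fst) → (∀ v x, 0 < ψ v x) →
      0 < M.computeZAux d L S ψ ∧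
      M.computeZAux d L S ψ ≤ ρ ^ L.length * M.subZ S ψ ∧
      M.subZ S ψ ≤ ρ ^ L.length * M.computeZAux d L S ψ := by
  induction L with
  | nil =>
    intro S ψ _ hS _
    have : S = ∅ := Finset.eq_empty_of_forall_notMem fun u hu => by simpa using (hS u).1 hu
    subst this
    simp [computeZAux]
  | cons a L ih =>
    obtain ⟨v, x⟩ := a
    intro S ψ hnd hS hψ
    rw [List.map_cons, List.nodup_cons] at hnd
    have hv : v ∈ S := (hS v).2 (by simp)
    have hS' : ∀ u, u ∈ S.erase v ↔ u ∈ L.map Prod.fst := by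
      intro u
      rw [Finset.mem_erase, hS u, List.map_cons, List.mem_cons]
      constructor
      · rintro ⟨h1, h2 | h2⟩
        exacts [absurd h2 h1, h2]
      · intro h
        exact ⟨fun e => hnd.1 (e ▸ h), Or.inr h⟩
    obtain ⟨h0, h1, h2⟩ := ih (S.erase v) (M.pin v x ψ) hnd.2 hS' (pin_pos hf hψ v x)
    obtain ⟨w1, w2⟩ := hW S ψ v x hψ hv
    have hPhi := Phi_pos (M := M) hq hf d S ψ v x hψ
    have hZ := subZ_pos (M := M) hq hf S hψ
    have hZ' := subZ_pos (M := M) hq hf (S.erase v) (pin_pos hf hψ v x)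
    have hmarg := marginal_pos (M := M) hq hf S hψ v x
    have e : ψ v x * M.subZ (S.erase v) (M.pin v x ψ) = M.marginal S ψ v x * M.subZ S ψ := by
      rw [marginal, div_mul_cancel₀ _ hZ.ne']
    rw [computeZAux, List.length_cons]
    generalize M.computeZAux d L (S.erase v) (M.pin v x ψ) = A at *
    generalize M.subZ (S.erase v) (M.pin v x ψ) = B at *
    generalize M.subZ S ψ = Z at *
    generalize M.marginal S ψ v x = P at *
    generalize M.Phi d S ψ v x = F at *
    have hρL : 0 < ρ ^ L.length := pow_pos hρ _
    have hψv := hψ v x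
    refine ⟨by positivity, ?_, ?_⟩
    · rw [mul_assoc, mul_left_comm, inv_mul_le_iff₀ hPhi]
      calc ψ v x * A ≤ ψ v x * (ρ ^ L.length * B) := by gcongr
        _ = ρ ^ L.length * (P * Z) := by rw [← e]; ring
        _ ≤ ρ ^ L.length * (ρ * F * Z) := by gcongr
        _ = _ := by ring
    · have h3 : P * Z ≤ P * (ρ ^ (L.length + 1) * (ψ v x * F⁻¹ * A)) := by
        calc P * Z = ψ v x * B := e.symm
          _ ≤ ψ v x * (ρ ^ L.length * A) := by gcongr
          _ = ρ ^ L.length * (ψ v x * F⁻¹ * A) * F := by field_simp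
          _ ≤ ρ ^ L.length * (ψ v x * F⁻¹ * A) * (ρ * P) := by gcongr
          _ = _ := by ring
      exact le_of_mul_le_mul_left h3 hmarg

/-- The hypotheses `1 ≤ c` and `hcf` of the contraction lemmas hold for some `c` with
`c ^ Δ = c_f ^ Δ`. (With no edges, `c_f` is the junk value `0` and `Δ = 0`.) -/
theorem exists_ratio_bound (M : MRF N q) (hq : 0 < q)
    (hf : ∀ u v, M.graph.Adj u v → ∀ x y, 0 < M.f u v x y) :
    ∃ c : ℝ, 1 ≤ c ∧ c ^ M.maxDegree = M.cf ^ M.maxDegree ∧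
      ∀ u v, M.graph.Adj u v → ∀ x x' y, M.f u v x y ≤ c * M.f u v x' y := by
  classical
  have hfin : M.fValues.Finite := by
    refine (Set.finite_range fun p : Fin N × Fin N × Fin q × Fin q =>
      M.f p.1 p.2.1 p.2.2.1 p.2.2.2).subset ?_
    rintro r ⟨u, v, x, y, -, rfl⟩
    exact ⟨(u, v, x, y), rfl⟩
  by_cases hE : ∃ u v, M.graph.Adj u v
  · obtain ⟨u₀, v₀, h₀⟩ := hE
    have hne : M.fValues.Nonempty := ⟨_, u₀, v₀, ⟨0, hq⟩, ⟨0, hq⟩, h₀, rfl⟩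
    have hminpos : 0 < M.fMin := by
      obtain ⟨u, v, x, y, h, he⟩ := hne.csInf_mem hfin
      rw [fMin, he]
      exact hf u v h x y
    have hmin : ∀ u v, M.graph.Adj u v → ∀ x y, M.fMin ≤ M.f u v x y := fun u v h x y =>
      csInf_le hfin.bddBelow ⟨u, v, x, y, h, rfl⟩
    have hmax : ∀ u v, M.graph.Adj u v → ∀ x y, M.f u v x y ≤ M.fMax := fun u v h x y =>
      le_csSup hfin.bddAbove ⟨u, v, x, y, h, rfl⟩
    have hc : 1 ≤ M.cf := by
      rw [cf, one_le_div hminpos]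
      exact (hmin _ _ h₀ ⟨0, hq⟩ ⟨0, hq⟩).trans (hmax _ _ h₀ _ _)
    refine ⟨M.cf, hc, rfl, fun u v h x x' y => ?_⟩
    calc M.f u v x y ≤ M.fMax := hmax u v h x y
      _ = M.cf * M.fMin := by rw [cf, div_mul_cancel₀ _ hminpos.ne']
      _ ≤ _ := mul_le_mul_of_nonneg_left (hmin u v h x' y) (by linarith)
  · push Not at hE
    have hd : M.maxDegree = 0 := by
      unfold maxDegree
      refine Nat.le_zero.1 (SimpleGraph.maxDegree_le_of_forall_degree_le _ _ fun v => ?_)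
      rw [← SimpleGraph.card_neighborFinset_eq_degree, Nat.le_zero, Finset.card_eq_zero]
      exact Finset.eq_empty_of_forall_notMem fun u hu =>
        hE v u ((SimpleGraph.mem_neighborFinset _ _ _).1 hu)
    exact ⟨1, le_rfl, by simp [hd], fun u v h => absurd h (hE u v)⟩

/-- ComputeZ with depth `d + 1` has relative error at most `δ` as soon as
`N (1 + 1/δ) (7/8)ᵈ ≤ 1`, for every resolution of its choices. -/
theorem computeZ_accuracy {M : MRF N q} (hq : 0 < q) (hφ : ∀ v x, 0 < M.φ v x)
    (hf : ∀ u v, M.graph.Adj u v → ∀ x y, 0 < M.f u v x y) (hγ : M.gamma < 1) {δ : ℝ}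
    (hδ : 0 < δ) {d : ℕ} (hd : N * (1 + 1 / δ) * (7 / 8) ^ d ≤ 1)
    {choices : List (Fin N × Fin q)} (hch : Admissible choices) :
    1 - δ ≤ M.computeZ (d + 1) choices / M.Z ∧ M.computeZ (d + 1) choices / M.Z ≤ 1 + δ := by
  obtain ⟨c, hc, hcc, hcf⟩ := exists_ratio_bound M hq hf
  obtain ⟨K, hK⟩ : ∃ K, K = c ^ M.maxDegree := ⟨_, rfl⟩
  have hγ' : (K - K⁻¹) * M.maxDegree * (q : ℝ) ^ M.maxDegree < 1 := by
    rw [hK, hcc]; exact hγ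
  have hK1 : 1 ≤ K := hK ▸ one_le_pow₀ hc
  have ht0 : 0 ≤ K - K⁻¹ := by linarith [inv_le_one_of_one_le₀ hK1]
  have ht : K - K⁻¹ ≤ 1 := by
    rcases Nat.eq_zero_or_pos M.maxDegree with h0 | h0
    · rw [hK, h0]; norm_num
    · have h1 : (1 : ℝ) ≤ M.maxDegree := by exact_mod_cast h0
      have h2 : (1 : ℝ) ≤ (q : ℝ) ^ M.maxDegree := one_le_pow₀ (by exact_mod_cast hq)
      have h3 : K - K⁻¹ ≤ (K - K⁻¹) * M.maxDegree := le_mul_of_one_le_right ht0 h1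
      have h4 : (K - K⁻¹) * M.maxDegree ≤ (K - K⁻¹) * M.maxDegree * (q : ℝ) ^ M.maxDegree :=
        le_mul_of_one_le_right (by linarith) h2
      linarith
  have hW := within_marginal_Phi hq hf hc hcf hK hγ' d
  have hlen : choices.length = N := by
    simpa using hch.length_eq
  have hnd : (choices.map Prod.fst).Nodup := hch.nodup_iff.2 (List.nodup_finRange N)
  obtain ⟨h0, h1, h2⟩ := computeZAux_bounds hq hf (Real.exp_pos _) hW choices Finset.univ M.φ hnd
    (fun u => by simp [hch.mem_iff]) hφ
  rw [← Z_eq_subZ M hq, ← computeZ, hlen, ← Real.exp_nat_mul] at h1 h2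
  rw [← computeZ] at h0
  have hE : Real.exp (N * ((7 / 8) ^ d * (K - K⁻¹))) ≤ 1 + δ := by
    have h3 : (N : ℝ) * ((7 / 8) ^ d * (K - K⁻¹)) ≤ δ / (1 + δ) := by
      have h4 : (N : ℝ) * (7 / 8) ^ d ≤ δ / (1 + δ) := by
        rw [le_div_iff₀ (by linarith)]
        have : (1 + 1 / δ) * δ = 1 + δ := by field_simp; ring
        calc (N : ℝ) * (7 / 8) ^ d * (1 + δ) = N * (1 + 1 / δ) * (7 / 8) ^ d * δ := by
              rw [← this]; ring
          _ ≤ 1 * δ := mul_le_mul_of_nonneg_right hd hδ.le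
          _ = δ := one_mul δ
      have h5 : (0 : ℝ) ≤ N * (7 / 8) ^ d := by positivity
      nlinarith
    have h6 : δ / (1 + δ) ≤ Real.log (1 + δ) := by
      have := Real.one_sub_inv_le_log_of_pos (show 0 < 1 + δ by linarith)
      have e : δ / (1 + δ) = 1 - (1 + δ)⁻¹ := by field_simp; ring
      linarith
    calc _ ≤ Real.exp (Real.log (1 + δ)) := Real.exp_le_exp.2 (h3.trans h6)
      _ = _ := Real.exp_log (by linarith)
  have hZ : 0 < M.Z := by rw [Z_eq_subZ M hq]; exact subZ_pos hq hf _ hφ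
  generalize M.computeZ (d + 1) choices = A at *
  constructor
  · rw [le_div_iff₀ hZ]
    have : M.Z ≤ (1 + δ) * A := h2.trans (mul_le_mul_of_nonneg_right hE h0.le)
    by_cases hδ1 : δ ≤ 1
    · have h3 := mul_le_mul_of_nonneg_left this (sub_nonneg.2 hδ1)
      nlinarith [mul_pos h0 (mul_pos hδ hδ)]
    · nlinarith
  · rw [div_le_iff₀ hZ]
    exact h1.trans (mul_le_mul_of_nonneg_right hE hZ.le)

end MRF

namespace RealProg

/-! ### Evaluation with a bound on the number of steps -/

/-- `EvalLE P env e v T`: the evaluation of `e` terminates with value `v` after at most `T`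
steps. -/
def EvalLE (P : Program) (env : List Val) (e : Expr) (v : Val) (T : ℕ) : Prop :=
  ∃ t ≤ T, Eval P env e v t

namespace EvalLE

variable {P : Program} {env : List Val} {a b s t : Expr} {v va vb : Val} {T T' ta tb tc : ℕ}

theorem mono (h : EvalLE P env a v T) (hT : T ≤ T') : EvalLE P env a v T' := by
  obtain ⟨t, ht, h⟩ := h
  exact ⟨t, ht.trans hT, h⟩

theorem var {i : ℕ} (h : env[i]? = some v) : EvalLE P env (.var i) v 1 := ⟨1, le_rfl, .var h⟩

theorem const {k : ℕ} : EvalLE P env (.const k) (.num k) 1 := ⟨1, le_rfl, .const⟩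

theorem zero : EvalLE P env (.const 0) (.num 0) 1 := by simpa using const (k := 0)

theorem one : EvalLE P env (.const 1) (.num 1) 1 := by simpa using const (k := 1)

theorem nil : EvalLE P env .nil .nil 1 := ⟨1, le_rfl, .nil⟩

theorem pair (ha : EvalLE P env a va ta) (hb : EvalLE P env b vb tb) :
    EvalLE P env (.pair a b) (.pair va vb) (ta + tb + 1) := by
  obtain ⟨t1, l1, h1⟩ := ha
  obtain ⟨t2, l2, h2⟩ := hb
  exact ⟨_, by omega, h1.pair h2⟩

theorem fst (ha : EvalLE P env a (.pair va vb) ta) : EvalLE P env (.fst a) va (ta + 1) := by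
  obtain ⟨t1, l1, h1⟩ := ha
  exact ⟨_, by omega, h1.fst⟩

theorem snd (ha : EvalLE P env a (.pair va vb) ta) : EvalLE P env (.snd a) vb (ta + 1) := by
  obtain ⟨t1, l1, h1⟩ := ha
  exact ⟨_, by omega, h1.snd⟩

theorem arith {op : ArithOp} {r r' z : ℝ} (ha : EvalLE P env a (.num r) ta)
    (hb : EvalLE P env b (.num r') tb) (hz : op.Apply r r' z) :
    EvalLE P env (.arith op a b) (.num z) (ta + tb + 1) := by
  obtain ⟨t1, l1, h1⟩ := ha
  obtain ⟨t2, l2, h2⟩ := hb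
  exact ⟨_, by omega, h1.arith h2 hz⟩

theorem add {r r' : ℝ} (ha : EvalLE P env a (.num r) ta) (hb : EvalLE P env b (.num r') tb) :
    EvalLE P env (.arith .add a b) (.num (r + r')) (ta + tb + 1) := arith ha hb rfl

theorem mul {r r' : ℝ} (ha : EvalLE P env a (.num r) ta) (hb : EvalLE P env b (.num r') tb) :
    EvalLE P env (.arith .mul a b) (.num (r * r')) (ta + tb + 1) := arith ha hb rfl

theorem div {r r' : ℝ} (ha : EvalLE P env a (.num r) ta) (hb : EvalLE P env b (.num r') tb)
    (h : r' ≠ 0) : EvalLE P env (.arith .div a b) (.num (r / r')) (ta + tb + 1) :=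
  arith ha hb ⟨h, rfl⟩

theorem ifLe_true {r r' : ℝ} (ha : EvalLE P env a (.num r) ta) (hb : EvalLE P env b (.num r') tb)
    (h : r ≤ r') (hs : EvalLE P env s v tc) :
    EvalLE P env (.ifLe a b s t) v (ta + tb + tc + 1) := by
  obtain ⟨t1, l1, h1⟩ := ha
  obtain ⟨t2, l2, h2⟩ := hb
  obtain ⟨t3, l3, h3⟩ := hs
  exact ⟨_, by omega, h1.ifLe_true h2 h h3⟩

theorem ifLe_false {r r' : ℝ} (ha : EvalLE P env a (.num r) ta) (hb : EvalLE P env b (.num r') tb)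
    (h : r' < r) (ht : EvalLE P env t v tc) :
    EvalLE P env (.ifLe a b s t) v (ta + tb + tc + 1) := by
  obtain ⟨t1, l1, h1⟩ := ha
  obtain ⟨t2, l2, h2⟩ := hb
  obtain ⟨t3, l3, h3⟩ := ht
  exact ⟨_, by omega, h1.ifLe_false h2 h h3⟩

theorem ifNil_nil (ha : EvalLE P env a .nil ta) (hs : EvalLE P env s v tc) :
    EvalLE P env (.ifNil a s t) v (ta + tc + 1) := by
  obtain ⟨t1, l1, h1⟩ := ha
  obtain ⟨t3, l3, h3⟩ := hs
  exact ⟨_, by omega, h1.ifNil_nil h3⟩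

theorem ifNil_pair (ha : EvalLE P env a (.pair va vb) ta) (ht : EvalLE P env t v tc) :
    EvalLE P env (.ifNil a s t) v (ta + tc + 1) := by
  obtain ⟨t1, l1, h1⟩ := ha
  obtain ⟨t3, l3, h3⟩ := ht
  exact ⟨_, by omega, h1.ifNil_pair h3⟩

theorem letIn (ha : EvalLE P env a va ta) (hb : EvalLE P (va :: env) b v tb) :
    EvalLE P env (.letIn a b) v (ta + tb + 1) := by
  obtain ⟨t1, l1, h1⟩ := ha
  obtain ⟨t2, l2, h2⟩ := hb
  exact ⟨_, by omega, h1.letIn h2⟩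

theorem call {k : ℕ} {body : Expr} (ha : EvalLE P env a va ta) (hk : P[k]? = some body)
    (hb : EvalLE P [va] body v tb) : EvalLE P env (.call k a) v (ta + tb + 1) := by
  obtain ⟨t1, l1, h1⟩ := ha
  obtain ⟨t2, l2, h2⟩ := hb
  exact ⟨_, by omega, h1.call hk h2⟩

end EvalLE

/-! ### The program -/

open RealProg.Expr in
/-- `find (l, u)`: the payload of the key `u` in the association list `l`, or the empty list. -/
def findBody : Expr :=
  ifNil (fst (var 0)) nil
    (ifLe (fst (fst (fst (var 0)))) (snd (var 0))
      (ifLe (snd (var 0)) (fst (fst (fst (var 0))))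
        (snd (fst (fst (var 0))))
        (call 1 (pair (snd (fst (var 0))) (snd (var 0)))))
      (call 1 (pair (snd (fst (var 0))) (snd (var 0)))))

open RealProg.Expr in
/-- `nth (l, k)`: the entry of `l` at the unary position `k`. -/
def nthBody : Expr :=
  ifNil (snd (var 0)) (fst (fst (var 0))) (call 2 (pair (snd (fst (var 0))) (snd (snd (var 0)))))

open RealProg.Expr in
/-- `factor (M, v, x, u, y)`: the factor `f_{v,u}(x, y)` if `u` is a neighbour of `v`, else `1`. -/
def factorBody : Expr :=
  letIn
    (call 1 (pair (snd (call 1 (pair (fst (var 0)) (fst (snd (var 0))))))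
      (fst (snd (snd (snd (var 0)))))))
    (ifNil (var 0) (const 1)
      (call 2 (pair (call 2 (pair (var 0) (fst (snd (snd (var 1))))))
        (snd (snd (snd (snd (var 1))))))))

open RealProg.Expr in
/-- `psi (M, h, u, y)`: the potential `ψ_u(y)` after the pinnings of `h`. -/
def psiBody : Expr :=
  ifNil (fst (snd (var 0)))
    (call 2 (pair (fst (call 1 (pair (fst (var 0)) (fst (snd (snd (var 0)))))))
      (snd (snd (snd (var 0))))))
    (arith .mul
      (call 4 (pair (fst (var 0)) (pair (snd (fst (snd (var 0)))) (snd (snd (var 0))))))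
      (call 3 (pair (fst (var 0)) (pair (fst (fst (fst (snd (var 0)))))
        (pair (snd (fst (fst (snd (var 0))))) (snd (snd (var 0))))))))

open RealProg.Expr in
/-- `sumLetters ((K, d, R, h, v, x, l), k)`, with `K = (M, q)`: the part of the sum over the letter
`y` of the first node of `l` with `y < k`. -/
def sumLettersBody : Expr :=
  ifNil (snd (var 0)) (const 0)
    (letIn (fst (var 0)) <|
     letIn (snd (snd (snd (snd (snd (snd (var 0))))))) <|
     letIn (snd (snd (var 2))) <|
      -- the variables are now `y`, `l`, the first component of the argument, and the argument
      arith .add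
        (arith .mul
          (arith .mul
            (call 2 (pair (call 2 (pair (snd (fst (var 1)))
              (fst (snd (snd (snd (snd (snd (var 2)))))))))
              (var 0)))
            (call 7 (pair (fst (var 2)) (pair (fst (snd (var 2)))
              (pair (fst (snd (snd (var 2)))) (pair (fst (snd (snd (snd (var 2)))))
                (pair (fst (fst (var 1))) (var 0))))))))
          (call 6 (pair (fst (var 2)) (pair (fst (snd (var 2)))
            (pair (pair (pair (fst (fst (var 1))) (pair nil nil)) (fst (snd (snd (var 2)))))
              (pair (pair (pair (fst (fst (var 1))) (var 0)) (fst (snd (snd (snd (var 2))))))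
                (pair (fst (snd (snd (snd (snd (var 2))))))
                  (pair (fst (snd (snd (snd (snd (snd (var 2))))))) (snd (var 1))))))))))
        (call 5 (pair (var 2) (var 0))))

open RealProg.Expr in
/-- `iter (K, d, R, h, v, x, l)`: the iterated sum over the nodes of `l` which are not in `R`. -/
def iterBody : Expr :=
  letIn (snd (snd (snd (snd (snd (snd (var 0))))))) <|
  ifNil (var 0) (const 1)
    (ifNil (call 1 (pair (fst (snd (snd (var 1)))) (fst (fst (var 0)))))
      (call 5 (pair (var 1) (snd (fst (var 1)))))
      (call 6 (pair (fst (var 1)) (pair (fst (snd (var 1))) (pair (fst (snd (snd (var 1))))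
        (pair (fst (snd (snd (snd (var 1))))) (pair (fst (snd (snd (snd (snd (var 1))))))
          (pair (fst (snd (snd (snd (snd (snd (var 1)))))))
            (snd (var 0))))))))))

open RealProg.Expr in
/-- `Phi (K, d, R, h, v, x)`: the surrogate of depth `d`. -/
def phiBody : Expr :=
  ifNil (fst (snd (var 0))) (const 1)
    (letIn
      (pair (fst (var 0)) (pair (snd (fst (snd (var 0))))
        (pair (pair (pair (fst (snd (snd (snd (snd (var 0)))))) (pair nil nil))
            (fst (snd (snd (var 0)))))
          (pair (fst (snd (snd (snd (var 0))))) (pair (fst (snd (snd (snd (snd (var 0))))))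
            (snd (call 1 (pair (fst (fst (var 0))) (fst (snd (snd (snd (snd (var 0))))))))))))))
      (arith .div (call 8 (pair (var 0) (snd (snd (snd (snd (snd (var 1))))))))
        (call 9 (pair (var 0) (snd (fst (var 0)))))))

open RealProg.Expr in
/-- `term ((K, d, R, h, v, l), x)`: the term `ψ_v(x) A(x)`. -/
def termBody : Expr :=
  letIn (fst (var 0)) <|
  arith .mul
    (call 4 (pair (fst (fst (var 0))) (pair (fst (snd (snd (snd (var 0)))))
      (pair (fst (snd (snd (snd (snd (var 0)))))) (snd (var 1))))))
    (call 6 (pair (fst (var 0)) (pair (fst (snd (var 0))) (pair (fst (snd (snd (var 0))))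
      (pair (fst (snd (snd (snd (var 0))))) (pair (fst (snd (snd (snd (snd (var 0))))))
        (pair (snd (var 1)) (snd (snd (snd (snd (snd (var 0)))))))))))))

open RealProg.Expr in
/-- `denominator (B, k)`: the sum of `term (B, x)` over the letters `x < k`. -/
def denominatorBody : Expr :=
  ifNil (snd (var 0)) (const 0)
    (arith .add (call 8 (pair (fst (var 0)) (snd (snd (var 0)))))
      (call 9 (pair (fst (var 0)) (snd (snd (var 0))))))

open RealProg.Expr in
/-- `depth s`: the depth, at least `1`, for which the decay `(7/8)ᵈ⁻¹ s` is at most `1`. -/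
def depthBody : Expr :=
  ifLe (var 0) (const 1) (pair nil nil)
    (pair nil (call 10 (arith .div (arith .mul (var 0) (const 7)) (const 8))))

open RealProg.Expr in
/-- `count l`: the length of `l`, as a real number. -/
def countBody : Expr :=
  ifNil (var 0) (const 0) (arith .add (const 1) (call 11 (snd (var 0))))

open RealProg.Expr in
/-- `unary l`: the length of `l`, in unary. -/
def unaryBody : Expr :=
  ifNil (var 0) nil (pair nil (call 12 (snd (var 0))))

open RealProg.Expr in
/-- `loop ((K, d), R, h, l)`: the loop of ComputeZ over the nodes of `l`, each of them with
letter `0`. -/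
def loopBody : Expr :=
  ifNil (snd (snd (snd (var 0)))) (const 1)
    (letIn (fst (fst (snd (snd (snd (var 0)))))) <|
      arith .mul
        (arith .div
          (call 4 (pair (fst (fst (fst (var 1)))) (pair (fst (snd (snd (var 1))))
            (pair (var 0) nil))))
          (call 7 (pair (fst (fst (var 1))) (pair (snd (fst (var 1))) (pair (fst (snd (var 1)))
            (pair (fst (snd (snd (var 1)))) (pair (var 0) nil)))))))
        (call 13 (pair (fst (var 1)) (pair (pair (pair (var 0) (pair nil nil)) (fst (snd (var 1))))
          (pair (pair (pair (var 0) nil) (fst (snd (snd (var 1)))))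
            (snd (snd (snd (snd (var 1))))))))))

open RealProg.Expr in
/-- The main function: for `N` nodes, the depth is computed from `N (1 + 1/δ)`. -/
def mainBody : Expr :=
  ifNil (snd (var 0)) (const 1)
    (call 13 (pair
      (pair (pair (snd (var 0)) (call 12 (fst (snd (fst (snd (var 0)))))))
        (call 10 (arith .mul (call 11 (snd (var 0)))
          (arith .add (const 1) (arith .div (const 1) (fst (var 0)))))))
      (pair nil (pair nil (snd (var 0))))))

/-- The program of the approximation scheme. A letter `x` and the depth `d` are represented in unary,
as lists of this length. An intermediate instance is represented by the list `R` of the removed nodes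
(each paired with a non-empty payload) and by the list `h` of the pairs `(v, x)` that have been
pinned; the potential of a node is recomputed from `h` and the original instance whenever it is
needed. -/
def fptas : Program :=
  [mainBody, findBody, nthBody, factorBody, psiBody, sumLettersBody, iterBody, phiBody, termBody,
    denominatorBody, depthBody, countBody, unaryBody, loopBody]

/-! ### Correctness and cost of the data-structure functions -/

/-- The unary representation of a natural number. -/
def Val.unary : ℕ → Val
  | 0 => .nil
  | k + 1 => .pair .nil (Val.unary k)

/-- An association list with the nodes of `l` as keys. -/
noncomputable def Val.assoc {N : ℕ} (l : List (Fin N)) (g : Fin N → Val) : Val :=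
  Val.ofList (l.map fun u : Fin N => .pair (.num (u : ℕ)) (g u))

/-- In this and the following lemmas, `ta` is the cost of evaluating the argument of the call. -/
theorem find_spec {N : ℕ} (u : Fin N) (g : Fin N → Val) :
    ∀ (l : List (Fin N)) {env : List Val} {a : Expr} {ta : ℕ},
      EvalLE fptas env a (.pair (Val.assoc l g) (.num (u : ℕ))) ta →
      EvalLE fptas env (.call 1 a) (if u ∈ l then g u else .nil) (ta + 40 * (l.length + 1)) := by
  intro l
  induction l with
  | nil =>
    intro env a ta ha
    have h : EvalLE fptas [.pair (Val.assoc [] g) (.num (u : ℕ))] findBody .nil _ :=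
      .ifNil_nil (.fst (.var rfl)) .nil
    exact (ha.call rfl h).mono (by simp only [List.length_nil]; omega)
  | cons w l ih =>
    intro env a ta ha
    have hl : EvalLE fptas [.pair (Val.assoc (w :: l) g) (.num (u : ℕ))] (.fst (.var 0))
      (.pair (.pair (.num (w : ℕ)) (g w)) (Val.assoc l g)) _ := .fst (.var rfl)
    have hu : EvalLE fptas [.pair (Val.assoc (w :: l) g) (.num (u : ℕ))] (.snd (.var 0))
      (.num (u : ℕ)) _ := .snd (.var rfl)
    have hrec := ih (hl.snd.pair hu)
    rcases lt_trichotomy u w with h | h | h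
    · have hlt : ((u : ℕ) : ℝ) < ((w : ℕ) : ℝ) := by exact_mod_cast h
      have := ha.call (k := 1) rfl (.ifNil_pair hl (.ifLe_false hl.fst.fst hu hlt hrec))
      simp only [List.mem_cons, h.ne, false_or]
      exact this.mono (by simp only [List.length_cons]; omega)
    · subst h
      have := ha.call (k := 1) rfl (.ifNil_pair hl (.ifLe_true hl.fst.fst hu le_rfl
        (.ifLe_true hu hl.fst.fst le_rfl hl.fst.snd)))
      simp only [List.mem_cons, true_or, if_true]
      exact this.mono (by simp only [List.length_cons]; omega)
    · have hlt : ((w : ℕ) : ℝ) < ((u : ℕ) : ℝ) := by exact_mod_cast h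
      have := ha.call (k := 1) rfl (.ifNil_pair hl (.ifLe_true hl.fst.fst hu hlt.le
        (.ifLe_false hu hl.fst.fst hlt hrec)))
      simp only [List.mem_cons, h.ne', false_or]
      exact this.mono (by simp only [List.length_cons]; omega)

theorem nth_spec_list : ∀ (l : List Val) (k : ℕ) (v : Val), l[k]? = some v →
    ∀ {env : List Val} {a : Expr} {ta : ℕ},
      EvalLE fptas env a (.pair (Val.ofList l) (Val.unary k)) ta →
      EvalLE fptas env (.call 2 a) v (ta + 20 * (k + 1)) := by
  intro l
  induction l with
  | nil => intro k v h; simp at h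
  | cons w l ih =>
    intro k v h env a ta ha
    cases k with
    | zero =>
      simp only [List.getElem?_cons_zero, Option.some.injEq] at h
      subst h
      have h : EvalLE fptas [.pair (Val.ofList (w :: l)) (Val.unary 0)] nthBody w _ :=
        .ifNil_nil (.snd (.var rfl)) (.fst (.fst (.var rfl)))
      exact (ha.call rfl h).mono (by omega)
    | succ k =>
      rw [List.getElem?_cons_succ] at h
      have h : EvalLE fptas [.pair (Val.ofList (w :: l)) (Val.unary (k + 1))] nthBody v _ :=
        .ifNil_pair (.snd (.var rfl)) (ih k v h (.pair (.snd (.fst (.var rfl)))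
          (.snd (.snd (.var rfl)))))
      exact (ha.call rfl h).mono (by omega)

theorem nth_spec {q : ℕ} (g : Fin q → Val) (x : Fin q) {env : List Val} {a : Expr} {ta : ℕ}
    (ha : EvalLE fptas env a (.pair (Val.table g) (Val.unary x)) ta) :
    EvalLE fptas env (.call 2 a) (g x) (ta + 20 * q) := by
  refine (nth_spec_list _ _ (g x) ?_ ha).mono (by have := x.2; omega)
  simp

theorem unary_spec : ∀ (l : List Val) {env : List Val} {a : Expr} {ta : ℕ},
    EvalLE fptas env a (Val.ofList l) ta →
    EvalLE fptas env (.call 12 a) (Val.unary l.length) (ta + 20 * (l.length + 1)) := by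
  intro l
  induction l with
  | nil =>
    intro env a ta ha
    have h : EvalLE fptas [Val.ofList []] unaryBody .nil _ := .ifNil_nil (.var rfl) .nil
    exact (ha.call rfl h).mono (by simp only [List.length_nil]; omega)
  | cons w l ih =>
    intro env a ta ha
    have h : EvalLE fptas [Val.ofList (w :: l)] unaryBody (Val.unary (l.length + 1)) _ :=
      .ifNil_pair (.var rfl) (.pair .nil (ih (.snd (.var rfl))))
    exact (ha.call rfl h).mono (by simp only [List.length_cons]; omega)

theorem count_spec : ∀ (l : List Val) {env : List Val} {a : Expr} {ta : ℕ},
    EvalLE fptas env a (Val.ofList l) ta →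
    EvalLE fptas env (.call 11 a) (.num l.length) (ta + 20 * (l.length + 1)) := by
  intro l
  induction l with
  | nil =>
    intro env a ta ha
    have h : EvalLE fptas [Val.ofList []] countBody _ _ := .ifNil_nil (.var rfl) .const
    exact (ha.call rfl h).mono (by simp only [List.length_nil]; omega)
  | cons w l ih =>
    intro env a ta ha
    have h : EvalLE fptas [Val.ofList (w :: l)] countBody _ _ :=
      .ifNil_pair (.var rfl) (.add .const (ih (.snd (.var rfl))))
    have e : (1 : ℕ) + (l.length : ℝ) = (((w :: l).length : ℕ) : ℝ) := by
      push_cast [List.length_cons]; ring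
    rw [e] at h
    exact (ha.call rfl h).mono (by simp only [List.length_cons]; omega)

/-- The function `depth` returns the least `d` with `s (7/8)ᵈ ≤ 1`, plus one. -/
theorem depth_spec (k : ℕ) : ∀ (s : ℝ), s * (7 / 8) ^ k ≤ 1 →
    ∃ d, d ≤ k ∧ s * (7 / 8) ^ d ≤ 1 ∧ (d ≠ 0 → 1 < s * (7 / 8) ^ (d - 1)) ∧
      ∀ {env : List Val} {a : Expr} {ta : ℕ}, EvalLE fptas env a (.num s) ta →
        EvalLE fptas env (.call 10 a) (Val.unary (d + 1)) (ta + 20 * (d + 1)) := by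
  have base : ∀ s : ℝ, s ≤ 1 → ∀ {env : List Val} {a : Expr} {ta : ℕ},
      EvalLE fptas env a (.num s) ta →
        EvalLE fptas env (.call 10 a) (Val.unary (0 + 1)) (ta + 20 * (0 + 1)) := by
    intro s hs env a ta ha
    have h : EvalLE fptas [.num s] depthBody (Val.unary 1) _ :=
      .ifLe_true (.var rfl) .const (by simpa using hs) (.pair .nil .nil)
    exact (ha.call rfl h).mono (by omega)
  induction k with
  | zero =>
    intro s hs
    exact ⟨0, le_rfl, hs, fun h => absurd rfl h, base s (by simpa using hs)⟩
  | succ k ih =>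
    intro s hs
    by_cases h1 : s ≤ 1
    · exact ⟨0, Nat.zero_le _, by simpa using h1, fun h => absurd rfl h, base s h1⟩
    · obtain ⟨d, hdk, hd, hd', hev⟩ := ih (s * (7 : ℕ) / (8 : ℕ)) (by
        calc _ = s * (7 / 8) ^ (k + 1) := by push_cast; ring
          _ ≤ 1 := hs)
      refine ⟨d + 1, by omega, ?_, ?_, ?_⟩
      · calc _ = s * (7 : ℕ) / (8 : ℕ) * (7 / 8) ^ d := by push_cast; ring
          _ ≤ 1 := hd
      · intro _
        rcases Nat.eq_zero_or_pos d with h0 | h0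
        · subst h0; simpa using h1
        · calc 1 < s * (7 : ℕ) / (8 : ℕ) * (7 / 8) ^ (d - 1) := hd' h0.ne'
            _ = s * (7 / 8) ^ (d - 1 + 1) := by push_cast; ring
            _ = _ := by congr 2; omega
      · intro env a ta ha
        have h : EvalLE fptas [.num s] depthBody (Val.unary (d + 1 + 1)) _ :=
          .ifLe_false (.var rfl) .const (by simpa using h1)
            (.pair .nil (hev (.div (.mul (.var rfl) .const) .const (by norm_num))))
        exact (ha.call rfl h).mono (by omega)

end RealProg

namespace RealProg

variable {N q : ℕ}

/-! ### Representation of the intermediate instances -/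

open Classical in
/-- The neighbours of `v` in increasing order. -/
noncomputable def adjList (M : MRF N q) (v : Fin N) : List (Fin N) :=
  (List.finRange N).filter fun u : Fin N => M.graph.Adj v u

theorem mem_adjList {M : MRF N q} {v u : Fin N} : u ∈ adjList M v ↔ M.graph.Adj v u := by
  simp [adjList]

theorem nodup_adjList (M : MRF N q) (v : Fin N) : (adjList M v).Nodup :=
  (List.nodup_finRange N).filter _

theorem length_adjList_le (M : MRF N q) (v : Fin N) : (adjList M v).length ≤ N := by
  classical
  rw [adjList]
  simpa using List.length_filter_le (fun u : Fin N => decide (M.graph.Adj v u)) (List.finRange N)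

/-- The table of `f_{v,u}`. -/
noncomputable def edgeTable (M : MRF N q) (v u : Fin N) : Val :=
  Val.table fun x => Val.table fun y => .num (M.f v u x y)

/-- What the encoding of an instance holds for the node `v`: the table of `φ_v` and the list of the
neighbours. -/
noncomputable def nodeData (M : MRF N q) (v : Fin N) : Val :=
  .pair (Val.table fun x => .num (M.φ v x)) (Val.assoc (adjList M v) (edgeTable M v))

theorem encodeMRF_eq (M : MRF N q) : encodeMRF M = Val.assoc (List.finRange N) (nodeData M) := rfl

/-- The node potentials after the pinnings of `h`, the last one first. -/
noncomputable def pinned (M : MRF N q) : List (Fin N × Fin q) → Fin N → Fin q → ℝ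
  | [] => M.φ
  | (v, x) :: h => M.pin v x (pinned M h)

theorem pinned_pos {M : MRF N q} (hφ : ∀ v x, 0 < M.φ v x)
    (hf : ∀ u v, M.graph.Adj u v → ∀ x y, 0 < M.f u v x y) (h : List (Fin N × Fin q)) :
    ∀ v x, 0 < pinned M h v x := by
  induction h with
  | nil => exact hφ
  | cons a h ih => exact MRF.pin_pos hf ih a.1 a.2

/-- The nodes that survive the removal of the nodes of `R`. -/
def survivors (R : List (Fin N)) : Finset (Fin N) := Finset.univ \ R.toFinset

theorem mem_survivors {R : List (Fin N)} {u : Fin N} : u ∈ survivors R ↔ u ∉ R := by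
  simp [survivors]

theorem survivors_erase (R : List (Fin N)) (u : Fin N) :
    (survivors R).erase u = survivors (u :: R) := by
  ext w
  simp [survivors]

/-- The list `R` of removed nodes as a value; the payloads are not empty, so that `find` decides
membership. -/
noncomputable def Val.removed (R : List (Fin N)) : Val := Val.assoc R fun _ => .pair .nil .nil

/-- The list of pinnings as a value. -/
noncomputable def Val.history (h : List (Fin N × Fin q)) : Val :=
  Val.ofList (h.map fun p : Fin N × Fin q => .pair (.num (p.1 : ℕ)) (Val.unary p.2))

/-! ### Correctness and cost of the functions on instances -/

theorem findNode_spec (M : MRF N q) (v : Fin N) {env : List Val} {a : Expr} {ta : ℕ}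
    (ha : EvalLE fptas env a (.pair (encodeMRF M) (.num (v : ℕ))) ta) :
    EvalLE fptas env (.call 1 a) (nodeData M v) (ta + 40 * (N + 1)) := by
  have := find_spec v (nodeData M) (List.finRange N) ha
  rwa [if_pos (List.mem_finRange v), List.length_finRange] at this

theorem factor_spec (M : MRF N q) (v u : Fin N) (x y : Fin q) {env : List Val} {a : Expr} {ta : ℕ}
    (ha : EvalLE fptas env a (.pair (encodeMRF M) (.pair (.num (v : ℕ)) (.pair (Val.unary x)
      (.pair (.num (u : ℕ)) (Val.unary y))))) ta) (c : ℝ)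
    (hc : c = if u ∈ adjList M v then M.f v u x y else 1) :
    EvalLE fptas env (.call 3 a) (.num c) (ta + 200 * (N + q + 1)) := by
  have hlen := length_adjList_le M v
  have h2 : EvalLE fptas [.pair (encodeMRF M) (.pair (.num (v : ℕ)) (.pair (Val.unary x)
      (.pair (.num (u : ℕ)) (Val.unary y))))] (.call 1 (.pair (.snd (.call 1 (.pair (.fst (.var 0))
      (.fst (.snd (.var 0)))))) (.fst (.snd (.snd (.snd (.var 0)))))))
      (if u ∈ adjList M v then edgeTable M v u else .nil) _ :=
    find_spec u (edgeTable M v) (adjList M v) (.pair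
      (.snd (findNode_spec M v (.pair (.fst (.var rfl)) (.fst (.snd (.var rfl))))))
      (.fst (.snd (.snd (.snd (.var rfl))))))
  by_cases hu : u ∈ adjList M v
  · rw [if_pos hu] at h2 hc
    subst hc
    have hpos : 0 < q := x.pos
    obtain ⟨va, vb, hp⟩ : ∃ va vb, edgeTable M v u = .pair va vb := by
      obtain ⟨n, rfl⟩ := Nat.exists_eq_succ_of_ne_zero hpos.ne'
      rw [edgeTable, Val.table, List.finRange_succ]
      exact ⟨_, _, rfl⟩
    exact (ha.call rfl (.letIn h2 (.ifNil_pair (.var (by rw [← hp]; rfl))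
      (nth_spec (fun y => .num (M.f v u x y)) y
        (.pair (nth_spec (fun x => Val.table fun y => .num (M.f v u x y)) x
          (.pair (.var rfl) (.fst (.snd (.snd (.var rfl))))))
          (.snd (.snd (.snd (.snd (.var rfl)))))))))).mono (by omega)
  · rw [if_neg hu] at h2 hc
    subst hc
    exact (ha.call rfl (.letIn h2 (.ifNil_nil (.var rfl) .one))).mono (by omega)

theorem psi_spec (M : MRF N q) (u : Fin N) (y : Fin q) : ∀ (h : List (Fin N × Fin q))
    {env : List Val} {a : Expr} {ta : ℕ},
    EvalLE fptas env a (.pair (encodeMRF M) (.pair (Val.history h) (.pair (.num (u : ℕ))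
      (Val.unary y)))) ta →
    EvalLE fptas env (.call 4 a) (.num (pinned M h u y))
      (ta + 300 * ((h.length + 1) * (N + q + 1))) := by
  intro h
  induction h with
  | nil =>
    intro env a ta ha
    refine (ha.call rfl (.ifNil_nil (.fst (.snd (.var rfl))) (nth_spec (fun x => .num (M.φ u x)) y
      (.pair (.fst (findNode_spec M u (.pair (.fst (.var rfl)) (.fst (.snd (.snd (.var rfl)))))))
        (.snd (.snd (.snd (.var rfl)))))))).mono ?_
    rw [List.length_nil, zero_add, one_mul]
    omega
  | cons p h ih =>
    obtain ⟨v, x⟩ := p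
    intro env a ta ha
    have e : pinned M ((v, x) :: h) u y =
        pinned M h u y * if u ∈ adjList M v then M.f v u x y else 1 := by
      by_cases hu : M.graph.Adj v u
      · simp only [pinned, MRF.pin, hu, if_true, mem_adjList]
      · simp only [pinned, MRF.pin, hu, if_false, mem_adjList, mul_one]
    rw [e]
    refine (ha.call rfl (.ifNil_pair (.fst (.snd (.var rfl))) (.mul
      (ih (.pair (.fst (.var rfl)) (.pair (.snd (.fst (.snd (.var rfl))))
        (.snd (.snd (.var rfl))))))
      (factor_spec M v u x y (.pair (.fst (.var rfl)) (.pair (.fst (.fst (.fst (.snd (.var rfl)))))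
        (.pair (.snd (.fst (.fst (.snd (.var rfl))))) (.snd (.snd (.var rfl)))))) _ rfl)))).mono ?_
    rw [List.length_cons, add_mul (h.length + 1), one_mul]
    generalize (h.length + 1) * (N + q + 1) = B
    omega

/-- The bundle `(K, d, R, h, v, ·)` with `K = (M, q)` which is passed between the functions. -/
noncomputable def bundle (M : MRF N q) (d : ℕ) (R : List (Fin N)) (h : List (Fin N × Fin q))
    (v : Fin N) (z : Val) : Val :=
  .pair (.pair (encodeMRF M) (Val.unary q)) (.pair (Val.unary d) (.pair (Val.removed R)
    (.pair (Val.history h) (.pair (.num (v : ℕ)) z))))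

/-- The function `Phi` of the program is correct at depth `d` and takes at most `T` steps beyond the
evaluation of its argument, as long as `R` and `h` have length at most `H`. -/
def PhiSpec (M : MRF N q) (d H T : ℕ) : Prop :=
  ∀ (R : List (Fin N)) (h : List (Fin N × Fin q)) (v : Fin N) (x : Fin q),
    R.length ≤ H → h.length ≤ H → ∀ {env : List Val} {a : Expr} {ta : ℕ},
    EvalLE fptas env a (bundle M d R h v (Val.unary x)) ta →
    EvalLE fptas env (.call 7 a) (.num (M.Phi d (survivors R) (pinned M h) v x)) (ta + T)

theorem sum_filter_lt_succ (g : Fin q → ℝ) {k : ℕ} (hk : k < q) :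
    ∑ y with y.val < k + 1, g y = g ⟨k, hk⟩ + ∑ y with y.val < k, g y := by
  have : (Finset.univ.filter fun y : Fin q => y.val < k + 1) =
      insert ⟨k, hk⟩ (Finset.univ.filter fun y : Fin q => y.val < k) := by
    ext y
    simp only [Finset.mem_filter, Finset.mem_univ, true_and, Finset.mem_insert, Fin.ext_iff]
    omega
  rw [this, Finset.sum_insert (by simp)]

theorem sum_filter_lt_card (g : Fin q → ℝ) : ∑ y : Fin q with y.val < q, g y = ∑ y, g y := by
  rw [Finset.filter_true_of_mem fun y _ => y.2]

/-- `A y` stands for the iterated sum over the remaining nodes after the first node `u` of the list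
has been fixed to `y`. -/
theorem sumLetters_spec (M : MRF N q) (d H T I : ℕ) (R : List (Fin N)) (h : List (Fin N × Fin q))
    (v : Fin N) (x : Fin q) (u : Fin N) (l : List (Fin N)) (hPhi : PhiSpec M d H T)
    (hR : R.length ≤ H) (hh : h.length ≤ H) (A : Fin q → ℝ)
    (hiter : ∀ (y : Fin q) {env : List Val} {a : Expr} {ta : ℕ},
      EvalLE fptas env a (bundle M d (u :: R) ((u, y) :: h) v
        (.pair (Val.unary x) (Val.assoc l (edgeTable M v)))) ta →
      EvalLE fptas env (.call 6 a) (.num (A y)) (ta + I)) (k : ℕ) (hk : k ≤ q) :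
    ∀ {env : List Val} {a : Expr} {ta : ℕ},
      EvalLE fptas env a (.pair (bundle M d R h v
        (.pair (Val.unary x) (Val.assoc (u :: l) (edgeTable M v)))) (Val.unary k)) ta →
      EvalLE fptas env (.call 5 a) (.num (∑ y with y.val < k,
        M.f v u x y * M.Phi d (survivors R) (pinned M h) u y * A y))
        (ta + (k * (T + I + 200 * (q + 1)) + 20)) := by
  induction k with
  | zero =>
    intro env a ta ha
    simp only [Nat.not_lt_zero, Finset.filter_false, Finset.sum_empty]
    exact (ha.call rfl (.ifNil_nil (.snd (.var rfl)) .zero)).mono (by omega)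
  | succ k ih =>
    intro env a ta ha
    rw [sum_filter_lt_succ _ (show k < q by omega)]
    refine EvalLE.mono (ha.call rfl (.ifNil_pair (.snd (.var rfl)) (.letIn (.fst (.var rfl))
      (.letIn (.snd (.snd (.snd (.snd (.snd (.snd (.var rfl))))))) (.letIn (.snd (.snd (.var rfl)))
      (.add (.mul (.mul
        (nth_spec (fun y => .num (M.f v u x y)) ⟨k, by omega⟩
          (.pair (nth_spec (fun x => Val.table fun y => .num (M.f v u x y)) x
            (.pair (.snd (.fst (.var rfl)))
              (.fst (.snd (.snd (.snd (.snd (.snd (.var rfl)))))))))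
            (.var rfl)))
        (hPhi R h u ⟨k, by omega⟩ hR hh
          (.pair (.fst (.var rfl)) (.pair (.fst (.snd (.var rfl)))
            (.pair (.fst (.snd (.snd (.var rfl)))) (.pair (.fst (.snd (.snd (.snd (.var rfl)))))
              (.pair (.fst (.fst (.var rfl))) (.var rfl))))))))
        (hiter ⟨k, by omega⟩
          (.pair (.fst (.var rfl)) (.pair (.fst (.snd (.var rfl)))
            (.pair (.pair (.pair (.fst (.fst (.var rfl))) (.pair .nil .nil))
                (.fst (.snd (.snd (.var rfl)))))
              (.pair (.pair (.pair (.fst (.fst (.var rfl))) (.var rfl))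
                  (.fst (.snd (.snd (.snd (.var rfl))))))
                (.pair (.fst (.snd (.snd (.snd (.snd (.var rfl))))))
                  (.pair (.fst (.snd (.snd (.snd (.snd (.snd (.var rfl)))))))
                    (.snd (.var rfl))))))))))
        (ih (by omega) (.pair (.var rfl) (.var rfl))))))))) ?_
    ring_nf
    omega

/-- The program skips the nodes of `l` that are in `R` when it reaches them, while `nbrs` filters
them out beforehand; as `l` has no duplicates, the nodes that the recursion adds to `R` do not
matter. The cost grows by a factor of at most `2 (q + 1)` for each node of `l`. -/
theorem iter_spec (M : MRF N q) (d H T X : ℕ) (v : Fin N) (x : Fin q) (hPhi : PhiSpec M d H T)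
    (hX : T + 400 * (H + q + 1) ≤ X) : ∀ (l : List (Fin N)), l.Nodup →
    (∀ u ∈ l, M.graph.Adj v u) → ∀ (R : List (Fin N)) (h : List (Fin N × Fin q)),
    R.length + l.length ≤ H → h.length + l.length ≤ H → ∀ {env : List Val} {a : Expr} {ta : ℕ},
      EvalLE fptas env a (bundle M d R h v
        (.pair (Val.unary x) (Val.assoc l (edgeTable M v)))) ta →
      EvalLE fptas env (.call 6 a) (.num (M.iterSum (M.Phi d) v x
        (l.filter fun u => u ∉ R) (survivors R) (pinned M h)))
        (ta + (2 * (q + 1)) ^ l.length * X) := by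
  intro l
  induction l with
  | nil =>
    intro _ _ R h _ _ env a ta ha
    simp only [List.filter_nil, MRF.iterSum, List.length_nil, pow_zero, one_mul]
    exact (ha.call rfl (.letIn (.snd (.snd (.snd (.snd (.snd (.snd (.var rfl)))))))
      (.ifNil_nil (.var rfl) .one))).mono (by omega)
  | cons u l ih =>
    intro hnd hadj R h hR hh env a ta ha
    obtain ⟨hul, hnd'⟩ := List.nodup_cons.1 hnd
    rw [List.length_cons] at hR hh
    have hadj' : ∀ w ∈ l, M.graph.Adj v w := fun w hw => hadj w (List.mem_cons_of_mem u hw)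
    have hmem := find_spec u (fun _ => .pair .nil .nil) R (env := [Val.assoc (u :: l) (edgeTable M v),
        bundle M d R h v (.pair (Val.unary x) (Val.assoc (u :: l) (edgeTable M v)))])
      (.pair (.fst (.snd (.snd (.var (i := 1) rfl)))) (.fst (.fst (.var (i := 0) rfl))))
    have hpow : 1 ≤ (2 * (q + 1)) ^ l.length := Nat.one_le_pow _ _ (by omega)
    have hpowX : X ≤ (2 * (q + 1)) ^ l.length * X := Nat.le_mul_of_pos_left _ hpow
    rw [List.length_cons, pow_succ']
    by_cases hu : u ∈ R
    · rw [if_pos hu] at hmem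
      rw [List.filter_cons_of_neg (by simpa using hu)]
      refine (ha.call rfl (.letIn (.snd (.snd (.snd (.snd (.snd (.snd (.var rfl)))))))
        (.ifNil_pair (.var rfl) (.ifNil_pair hmem
          (ih hnd' hadj' R h (by omega) (by omega)
            (.pair (.fst (.var rfl)) (.pair (.fst (.snd (.var rfl)))
              (.pair (.fst (.snd (.snd (.var rfl)))) (.pair (.fst (.snd (.snd (.snd (.var rfl)))))
                (.pair (.fst (.snd (.snd (.snd (.snd (.var rfl))))))
                  (.pair (.fst (.snd (.snd (.snd (.snd (.snd (.var rfl)))))))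
                    (.snd (.var rfl))))))))))))).mono ?_
      have : 2 * (q + 1) * (2 * (q + 1)) ^ l.length * X =
        2 * q * ((2 * (q + 1)) ^ l.length * X) + 2 * ((2 * (q + 1)) ^ l.length * X) := by ring
      rw [this]
      generalize (2 * (q + 1)) ^ l.length * X = Y at *
      generalize 2 * q * Y = Y'
      omega
    · rw [if_neg hu] at hmem
      rw [List.filter_cons_of_pos (by simpa using hu), MRF.iterSum, ← sum_filter_lt_card]
      have hfil : (l.filter fun w => w ∉ R) = l.filter fun w => w ∉ u :: R := by
        refine List.filter_congr fun w hw => ?_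
        have : w ≠ u := fun e => hul (e ▸ hw)
        simp [this]
      rw [hfil, survivors_erase]
      refine (ha.call rfl (.letIn (.snd (.snd (.snd (.snd (.snd (.snd (.var rfl)))))))
        (.ifNil_pair (.var rfl) (.ifNil_nil hmem
          (sumLetters_spec M d H T ((2 * (q + 1)) ^ l.length * X) R h v x u l hPhi (by omega)
            (by omega) _
            (fun y => ih hnd' hadj' (u :: R) ((u, y) :: h) (by rw [List.length_cons]; omega)
              (by rw [List.length_cons]; omega)) q le_rfl
            (.pair (.var rfl) (.snd (.fst (.var rfl))))))))).mono ?_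
      have h1 : q * (T + (2 * (q + 1)) ^ l.length * X + 200 * (q + 1)) ≤
          q * (2 * ((2 * (q + 1)) ^ l.length * X)) := Nat.mul_le_mul_left _ (by omega)
      have : 2 * (q + 1) * (2 * (q + 1)) ^ l.length * X =
        q * (2 * ((2 * (q + 1)) ^ l.length * X)) + 2 * ((2 * (q + 1)) ^ l.length * X) := by ring
      rw [this]
      generalize (2 * (q + 1)) ^ l.length * X = Y at *
      generalize q * (2 * Y) = Y' at *
      generalize q * (T + Y + 200 * (q + 1)) = Y'' at *
      omega

theorem term_spec (M : MRF N q) (d H T X : ℕ) (hPhi : PhiSpec M d H T)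
    (hX : T + 400 * (H + q + 1) ≤ X) (R : List (Fin N)) (h : List (Fin N × Fin q)) (v : Fin N)
    (hR : R.length + (adjList M v).length ≤ H) (hh : h.length + (adjList M v).length ≤ H)
    (x : Fin q) {env : List Val} {a : Expr} {ta : ℕ}
    (ha : EvalLE fptas env a (.pair (bundle M d R h v (Val.assoc (adjList M v) (edgeTable M v)))
      (Val.unary x)) ta) :
    EvalLE fptas env (.call 8 a) (.num (pinned M h v x * M.iterSum (M.Phi d) v x
        ((adjList M v).filter fun u => u ∉ R) (survivors R) (pinned M h)))
      (ta + (100 + 300 * ((H + 1) * (N + q + 1)) + (2 * (q + 1)) ^ (adjList M v).length * X)) := by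
  refine (ha.call rfl (.letIn (.fst (.var rfl)) (.mul
    (psi_spec M v x h (.pair (.fst (.fst (.var rfl))) (.pair (.fst (.snd (.snd (.snd (.var rfl)))))
      (.pair (.fst (.snd (.snd (.snd (.snd (.var rfl)))))) (.snd (.var rfl))))))
    (iter_spec M d H T X v x hPhi hX (adjList M v) (nodup_adjList M v)
      (fun u hu => mem_adjList.1 hu) R h hR hh
      (.pair (.fst (.var rfl)) (.pair (.fst (.snd (.var rfl)))
        (.pair (.fst (.snd (.snd (.var rfl)))) (.pair (.fst (.snd (.snd (.snd (.var rfl)))))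
          (.pair (.fst (.snd (.snd (.snd (.snd (.var rfl))))))
            (.pair (.snd (.var rfl)) (.snd (.snd (.snd (.snd (.snd (.var rfl)))))))))))))))).mono ?_
  have h1 : (h.length + 1) * (N + q + 1) ≤ (H + 1) * (N + q + 1) :=
    Nat.mul_le_mul_right _ (by omega)
  generalize (h.length + 1) * (N + q + 1) = B1 at *
  generalize (H + 1) * (N + q + 1) = B2 at *
  omega

theorem denominator_spec (M : MRF N q) (d : ℕ) (R : List (Fin N)) (h : List (Fin N × Fin q))
    (v : Fin N) (B : ℕ) (A : Fin q → ℝ)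
    (hterm : ∀ (x : Fin q) {env : List Val} {a : Expr} {ta : ℕ},
      EvalLE fptas env a (.pair (bundle M d R h v (Val.assoc (adjList M v) (edgeTable M v)))
        (Val.unary x)) ta → EvalLE fptas env (.call 8 a) (.num (A x)) (ta + B)) (k : ℕ)
    (hk : k ≤ q) : ∀ {env : List Val} {a : Expr} {ta : ℕ},
      EvalLE fptas env a (.pair (bundle M d R h v (Val.assoc (adjList M v) (edgeTable M v)))
        (Val.unary k)) ta →
      EvalLE fptas env (.call 9 a) (.num (∑ x with x.val < k, A x)) (ta + (k * (B + 50) + 20)) := by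
  induction k with
  | zero =>
    intro env a ta ha
    simp only [Nat.not_lt_zero, Finset.filter_false, Finset.sum_empty]
    exact (ha.call rfl (.ifNil_nil (.snd (.var rfl)) .zero)).mono (by omega)
  | succ k ih =>
    intro env a ta ha
    rw [sum_filter_lt_succ _ (show k < q by omega)]
    refine (ha.call rfl (.ifNil_pair (.snd (.var rfl)) (.add
      (hterm ⟨k, by omega⟩ (.pair (.fst (.var rfl)) (.snd (.snd (.var rfl)))))
      (ih (by omega) (.pair (.fst (.var rfl)) (.snd (.snd (.var rfl)))))))).mono ?_
    rw [add_mul k]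
    omega

/-- The neighbours of `v` among the survivors, as the program finds them. -/
theorem filter_adjList (M : MRF N q) (R : List (Fin N)) (v : Fin N) :
    ((adjList M v).filter fun u => u ∉ v :: R) = M.nbrs (survivors R) v := by
  classical
  rw [adjList, List.filter_filter, MRF.nbrs]
  refine List.filter_congr fun u _ => ?_
  have : M.graph.Adj v u → u ≠ v := fun h e => M.graph.irrefl (e ▸ h)
  by_cases h : M.graph.Adj v u
  · simp [h, this h, mem_survivors]
  · simp [h]

theorem length_adjList_le_maxDegree (M : MRF N q) (v : Fin N) :
    (adjList M v).length ≤ M.maxDegree := by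
  refine le_trans (le_of_eq ?_) (M.length_nbrs_le (Finset.univ.erase v) v)
  rw [show Finset.univ.erase v = survivors [v] by ext; simp [survivors], ← filter_adjList]
  congr 1
  refine (List.filter_eq_self.2 fun u hu => ?_).symm
  have : u ≠ v := fun e => M.graph.irrefl (e ▸ mem_adjList.1 hu)
  simp [this]

/-- The factor by which the cost of `Phi` grows with the depth. -/
def growth (q Δ : ℕ) : ℕ := 2 * (2 * (q + 1)) ^ (Δ + 1)

/-- One level of the recursion removes at most `Δ + 1` nodes, so that at depth `d` below the root
`R` and `h` have length at most `H + d (Δ + 1)`. The unit `X` bounds the cost of the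
data-structure operations at all depths. -/
theorem phi_spec {M : MRF N q} (hφ : ∀ v x, 0 < M.φ v x)
    (hf : ∀ u v, M.graph.Adj u v → ∀ x y, 0 < M.f u v x y) {Δ : ℕ} (hΔ : M.maxDegree ≤ Δ)
    (H X : ℕ) (d : ℕ) (hX : 1000 * ((H + d * (Δ + 1) + 1) * (N + q + 1)) ≤ X) :
    PhiSpec M d H (growth q Δ ^ d * X) := by
  induction d generalizing H with
  | zero =>
    intro R h v x hR hh env a ta ha
    rw [pow_zero, one_mul]
    have : 1 ≤ (H + 0 * (Δ + 1) + 1) * (N + q + 1) := Nat.mul_pos (by omega) (by omega)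
    generalize (H + 0 * (Δ + 1) + 1) * (N + q + 1) = B at *
    exact (ha.call rfl (.ifNil_nil (.fst (.snd (.var rfl))) .one)).mono (by omega)
  | succ d ih =>
    intro R h v x hR hh env a ta ha
    have hq : 0 < q := x.pos
    have hdeg := (length_adjList_le_maxDegree M v).trans hΔ
    have hX' : 1000 * ((H + Δ + 1 + d * (Δ + 1) + 1) * (N + q + 1)) ≤ X := by
      refine le_trans (le_of_eq ?_) hX
      ring
    have hPhi := ih (H + Δ + 1) hX'
    obtain ⟨B, hB⟩ : ∃ B, B = (H + Δ + 1 + 1) * (N + q + 1) := ⟨_, rfl⟩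
    have hBX : 1000 * B ≤ X :=
      (Nat.mul_le_mul_left _ (hB ▸ Nat.mul_le_mul_right _ (by omega))).trans hX'
    have hB2 : (H + Δ + 1) + (N + q + 1) ≤ B := by rw [hB]; nlinarith
    clear hX hX' ih
    have hden : 0 < ∑ x, pinned M h v x * M.iterSum (M.Phi d) v x (M.nbrs (survivors R) v)
        ((survivors R).erase v) (pinned M h) :=
      MRF.sum_iterSum_pos hq hf (MRF.Phi_pos hq hf d) _ (pinned_pos hφ hf h) v
    rw [MRF.Phi]
    rw [← filter_adjList, survivors_erase, ← sum_filter_lt_card] at hden ⊢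
    obtain ⟨Y, hY⟩ : ∃ Y, Y = growth q Δ ^ d * X := ⟨_, rfl⟩
    rw [← hY] at hPhi
    have hterm := fun (x : Fin q) => @term_spec N q M d (H + Δ + 1) Y
      (Y + X) hPhi (by omega) (v :: R) h v (by rw [List.length_cons]; omega)
      (by omega) x
    rw [← hB] at hterm
    refine (ha.call rfl (.ifNil_pair (.fst (.snd (.var rfl))) (.letIn
      (.pair (.fst (.var rfl)) (.pair (.snd (.fst (.snd (.var rfl))))
        (.pair (.pair (.pair (.fst (.snd (.snd (.snd (.snd (.var rfl)))))) (.pair .nil .nil))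
            (.fst (.snd (.snd (.var rfl)))))
          (.pair (.fst (.snd (.snd (.snd (.var rfl)))))
            (.pair (.fst (.snd (.snd (.snd (.snd (.var rfl))))))
              (.snd (findNode_spec M v (.pair (.fst (.fst (.var rfl)))
                (.fst (.snd (.snd (.snd (.snd (.var rfl))))))))))))))
      (.div (hterm x (.pair (.var rfl) (.snd (.snd (.snd (.snd (.snd (.var rfl))))))))
        (denominator_spec M d (v :: R) h v _ _ hterm q le_rfl
          (.pair (.var rfl) (.snd (.fst (.var rfl))))) hden.ne')))).mono ?_
    have hpow : (2 * (q + 1)) ^ (adjList M v).length ≤ (2 * (q + 1)) ^ Δ :=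
      Nat.pow_le_pow_right (by omega) hdeg
    have hg : 1 ≤ growth q Δ ^ d := Nat.one_le_pow _ _ (by unfold growth; positivity)
    set b := (2 * (q + 1)) ^ Δ with hb
    have hb1 : 1 ≤ b := Nat.one_le_pow _ _ (by omega)
    have hXY : X ≤ Y := hY ▸ Nat.le_mul_of_pos_left _ hg
    have e : growth q Δ ^ (d + 1) * X = (q + 1) * (4 * (b * Y)) := by
      rw [hY, hb, pow_succ, growth, pow_succ]
      ring
    rw [e, add_mul, one_mul]
    have h2 : (2 * (q + 1)) ^ (adjList M v).length * (Y + X) ≤ b * (2 * Y) :=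
      Nat.mul_le_mul hpow (by omega)
    have hbY : Y ≤ b * Y := Nat.le_mul_of_pos_left _ hb1
    have e2 : b * (2 * Y) = 2 * (b * Y) := by ring
    clear_value b
    clear hb e hY hB hpow hg hb1
    generalize (2 * (q + 1)) ^ (adjList M v).length * (Y + X) = W at *
    rw [e2] at h2
    generalize b * Y = V at *
    have h3 : q * (100 + 300 * B + W + 50) ≤ q * (4 * V) := Nat.mul_le_mul_left _ (by omega)
    generalize q * (100 + 300 * B + W + 50) = V1 at *
    generalize q * (4 * V) = V2 at *
    omega

end RealProg

namespace RealProg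

variable {N q : ℕ}

/-! ### The main loop and the choice of the depth -/

theorem loop_spec {M : MRF N q} (hq : 0 < q) (hφ : ∀ v x, 0 < M.φ v x)
    (hf : ∀ u v, M.graph.Adj u v → ∀ x y, 0 < M.f u v x y) (d H T : ℕ) (hPhi : PhiSpec M d H T)
    (l : List (Fin N)) : ∀ (R : List (Fin N)) (h : List (Fin N × Fin q)),
    R.length + l.length ≤ H → h.length + l.length ≤ H → ∀ {env : List Val} {a : Expr} {ta : ℕ},
      EvalLE fptas env a (.pair (.pair (.pair (encodeMRF M) (Val.unary q)) (Val.unary d))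
        (.pair (Val.removed R) (.pair (Val.history h) (Val.assoc l (nodeData M))))) ta →
      EvalLE fptas env (.call 13 a) (.num (M.computeZAux d (l.map fun v => (v, ⟨0, hq⟩))
        (survivors R) (pinned M h)))
        (ta + (l.length * (T + 300 * ((H + 1) * (N + q + 1)) + 200) + 20)) := by
  induction l with
  | nil =>
    intro R h _ _ env a ta ha
    exact (ha.call rfl (.ifNil_nil (.snd (.snd (.snd (.var rfl)))) .one)).mono (by omega)
  | cons v l ih =>
    intro R h hR hh env a ta ha
    rw [List.length_cons] at hR hh
    have hpos := MRF.Phi_pos hq hf d (survivors R) (pinned M h) v ⟨0, hq⟩ (pinned_pos hφ hf h)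
    rw [List.map_cons, MRF.computeZAux, survivors_erase, ← div_eq_mul_inv]
    refine (ha.call rfl (.ifNil_pair (.snd (.snd (.snd (.var rfl))))
      (.letIn (.fst (.fst (.snd (.snd (.snd (.var rfl)))))) (.mul
        (.div
          (psi_spec M v ⟨0, hq⟩ h (.pair (.fst (.fst (.fst (.var rfl))))
            (.pair (.fst (.snd (.snd (.var rfl)))) (.pair (.var rfl) .nil))))
          (hPhi R h v ⟨0, hq⟩ (by omega) (by omega) (.pair (.fst (.fst (.var rfl)))
            (.pair (.snd (.fst (.var rfl))) (.pair (.fst (.snd (.var rfl)))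
              (.pair (.fst (.snd (.snd (.var rfl)))) (.pair (.var rfl) .nil))))))
          hpos.ne')
        (ih (v :: R) ((v, ⟨0, hq⟩) :: h) (by rw [List.length_cons]; omega)
          (by rw [List.length_cons]; omega)
          (.pair (.fst (.var rfl)) (.pair
            (.pair (.pair (.var rfl) (.pair .nil .nil)) (.fst (.snd (.var rfl))))
            (.pair (.pair (.pair (.var rfl) .nil) (.fst (.snd (.snd (.var rfl)))))
              (.snd (.snd (.snd (.snd (.var rfl))))))))))))).mono ?_
    have h1 : (h.length + 1) * (N + q + 1) ≤ (H + 1) * (N + q + 1) :=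
      Nat.mul_le_mul_right _ (by omega)
    rw [List.length_cons, add_mul l.length, one_mul]
    generalize (h.length + 1) * (N + q + 1) = B1 at *
    generalize (H + 1) * (N + q + 1) = B2 at *
    generalize l.length * (T + 300 * B2 + 200) = B3 at *
    omega

/-- The program computes the depth `d + 1` for the least `d` with `N (1 + 1/δ) (7/8)ᵈ ≤ 1`, and
returns the output of ComputeZ with this depth. -/
theorem fptas_runs {M : MRF N q} (hq : 0 < q) (hφ : ∀ v x, 0 < M.φ v x)
    (hf : ∀ u v, M.graph.Adj u v → ∀ x y, 0 < M.f u v x y) {Δ : ℕ} (hΔ : M.maxDegree ≤ Δ)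
    {δ : ℝ} (hδ : 0 < δ) :
    ∃ d t : ℕ, N * (1 + 1 / δ) * (7 / 8) ^ d ≤ 1 ∧
      (d ≠ 0 → 1 < N * (1 + 1 / δ) * (7 / 8) ^ (d - 1)) ∧
      t ≤ (N + 1) * (2 * (growth q Δ ^ (d + 1) *
        (1000 * ((N + (d + 1) * (Δ + 1) + 1) * (N + q + 1))))) ∧
      fptas.Runs (encodeInput δ M)
        (.num (M.computeZ (d + 1) ((List.finRange N).map fun v => (v, ⟨0, hq⟩)))) t := by
  obtain ⟨k, hk⟩ : ∃ k : ℕ, (N : ℝ) * (1 + 1 / δ) * (7 / 8) ^ k ≤ 1 := by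
    have hs : (0 : ℝ) < N * (1 + 1 / δ) + 1 := by positivity
    obtain ⟨k, hk⟩ := exists_pow_lt_of_lt_one (inv_pos.2 hs) (show (7 / 8 : ℝ) < 1 by norm_num)
    refine ⟨k, ?_⟩
    have h1 : (N * (1 + 1 / δ) + 1) * (7 / 8 : ℝ) ^ k ≤ 1 := by
      calc _ ≤ (N * (1 + 1 / δ) + 1) * (N * (1 + 1 / δ) + 1)⁻¹ := by gcongr
        _ = 1 := mul_inv_cancel₀ hs.ne'
    have h2 : (0 : ℝ) < (7 / 8) ^ k := by positivity
    linarith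
  obtain ⟨d, -, hd, hd', hdepth⟩ := depth_spec k _ hk
  obtain ⟨X, hX⟩ : ∃ X, X = 1000 * ((N + (d + 1) * (Δ + 1) + 1) * (N + q + 1)) := ⟨_, rfl⟩
  have hPhi := phi_spec hφ hf hΔ N X (d + 1) hX.ge
  obtain ⟨T, hT⟩ : ∃ T, T = growth q Δ ^ (d + 1) * X := ⟨_, rfl⟩
  have hTX : X ≤ T :=
    hT ▸ Nat.le_mul_of_pos_left _ (Nat.one_le_pow _ _ (by unfold growth; positivity))
  have hX1 : 1000 * ((N + 1) * (N + q + 1)) ≤ X := by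
    rw [hX]
    exact Nat.mul_le_mul_left _ (Nat.mul_le_mul_right _ (by omega))
  have hX2 : 1000 * (N + q + d + 2) ≤ X := by
    rw [hX]
    refine Nat.mul_le_mul_left _ ?_
    have : d + 1 ≤ (d + 1) * (Δ + 1) := Nat.le_mul_of_pos_right _ (by omega)
    have h1 : 1 ≤ N + q := by omega
    nlinarith
  have hS : survivors ([] : List (Fin N)) = Finset.univ := by ext; simp [mem_survivors]
  suffices h : EvalLE fptas [encodeInput δ M] mainBody
      (.num (M.computeZ (d + 1) ((List.finRange N).map fun v => (v, ⟨0, hq⟩))))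
      ((N + 1) * (2 * T)) by
    obtain ⟨t, ht, hev⟩ := h
    exact ⟨d, t, hd, hd', by rwa [← hX, ← hT], _, rfl, hev⟩
  have hcost : N * (T + 300 * ((N + 1) * (N + q + 1)) + 200) ≤ N * (2 * T) :=
    Nat.mul_le_mul_left _ (by
      clear hX hT hPhi hk hd hd' hdepth
      generalize (N + 1) * (N + q + 1) = B at *
      omega)
  rw [add_mul, one_mul]
  rcases Nat.eq_zero_or_pos N with hN | hN
  · subst hN
    have hnil : encodeMRF M = .nil := by
      rw [encodeMRF_eq, List.finRange_zero]; rfl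
    have hin : encodeInput δ M = .pair (.num δ) .nil := by rw [encodeInput, hnil]
    rw [List.finRange_zero, hin]
    exact EvalLE.mono (.ifNil_nil (.snd (.var rfl)) .one) (by clear hX hX1 hT hcost; omega)
  · obtain ⟨n, rfl⟩ := Nat.exists_eq_succ_of_ne_zero hN.ne'
    have hcons : encodeMRF M = .pair (.pair (.num ((0 : Fin (n + 1)) : ℕ)) (nodeData M 0))
        (Val.assoc ((List.finRange n).map Fin.succ) (nodeData M)) := by
      rw [encodeMRF_eq, List.finRange_succ]; rfl
    have hloop := @loop_spec (n + 1) q M hq hφ hf (d + 1) (n + 1) T (hT ▸ hPhi)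
      (List.finRange (n + 1)) [] [] (by simp) (by simp)
    rw [hS, List.length_finRange] at hloop
    have hcount := @count_spec ((List.finRange (n + 1)).map fun u : Fin (n + 1) =>
      .pair (.num (u : ℕ)) (nodeData M u))
    rw [List.length_map, List.length_finRange] at hcount
    have hunary := @unary_spec ((List.finRange q).map fun x => .num (M.φ 0 x))
    rw [List.length_map, List.length_finRange] at hunary
    refine EvalLE.mono (.ifNil_pair (.snd (.var (congrArg some (congrArg (Val.pair _) hcons))))
      (hloop (.pair (.pair (.pair (.snd (.var rfl)) (hunary (.fst (.snd (.fst (.snd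
          (.var (congrArg some (congrArg (Val.pair _) hcons)))))))))
        (hdepth (.mul (hcount (.snd (.var rfl))) (.add .one (.div .one (.fst (.var rfl)) hδ.ne')))))
        (.pair .nil (.pair .nil (.snd (.var rfl))))))) ?_
    generalize (n + 1) * (T + 300 * ((n + 1 + 1) * (n + 1 + q + 1)) + 200) = V1 at *
    generalize (n + 1) * (2 * T) = V2 at *
    generalize (n + 1 + 1) * (n + 1 + q + 1) = V3 at *
    clear hX hT hPhi hk hd hd' hdepth
    omega

/-! ### Polynomial bounds -/

theorem le_size_left (M : MRF N q) : (N : ℝ) ≤ M.size := le_max_left _ _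

theorem card_alphabet_le_size (M : MRF N q) : (q : ℝ) ≤ M.size :=
  le_max_of_le_right (le_max_of_le_right (le_max_left _ _))

/-- As the depth `d + 1` is minimal, a constant raised to it is polynomial in `s`: it is bounded by
a power of the left-hand side. -/
theorem pow_depth_le {s : ℝ} (hs : 1 ≤ s) {a : ℝ} (ha : a ≤ s * (1 + s)) {d : ℕ}
    (hd : d ≠ 0 → 1 < a * (7 / 8) ^ (d - 1)) : (8 / 7 : ℝ) ^ (d + 1) ≤ 3 * s ^ 2 := by
  rcases Nat.eq_zero_or_pos d with h0 | h0
  · subst h0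
    norm_num
    nlinarith
  · obtain ⟨e, rfl⟩ := Nat.exists_eq_succ_of_ne_zero h0.ne'
    have h1 := hd h0.ne'
    simp only [Nat.succ_eq_add_one, Nat.add_sub_cancel] at h1 ⊢
    have h2 : (8 / 7 : ℝ) ^ e ≤ a := by
      have h3 : (7 / 8 : ℝ) ^ e * (8 / 7) ^ e = 1 := by rw [← mul_pow]; norm_num
      have h4 : (0 : ℝ) < (8 / 7) ^ e := by positivity
      nlinarith
    calc (8 / 7 : ℝ) ^ (e + 1 + 1) = 64 / 49 * (8 / 7) ^ e := by ring
      _ ≤ 64 / 49 * (s * (1 + s)) := by gcongr; exact h2.trans ha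
      _ ≤ _ := by nlinarith

end RealProg

theorem theorem3 :
    ∃ P : RealProg.Program, ∀ q Δ : ℕ, 0 < q → ∃ C : ℕ,
      ∀ (N : ℕ) (M : MRF N q),
        M.maxDegree ≤ Δ →
        (∀ v x, 0 < M.φ v x) →
        (∀ u v, M.graph.Adj u v → ∀ x y, 0 < M.f u v x y) →
        M.gamma < 1 →
        ∀ δ : ℝ, 0 < δ →
          ∃ (d t : ℕ) (Zhat : ℝ),
            P.Runs (RealProg.encodeInput δ M) (.num Zhat) t ∧
            (t : ℝ) ≤ C * (M.size + 1 / δ) ^ C ∧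
            (1 - δ ≤ Zhat / M.Z ∧ Zhat / M.Z ≤ 1 + δ) ∧
            1 ≤ d ∧ (d : ℝ) ≤ C * Real.log (1 + M.size + 1 / δ) ∧
            (∃ choices, MRF.Admissible choices ∧ Zhat = M.computeZ d choices) ∧
            (∀ choices, MRF.Admissible choices →
              1 - δ ≤ M.computeZ d choices / M.Z ∧ M.computeZ d choices / M.Z ≤ 1 + δ) := by
  refine ⟨RealProg.fptas, fun q Δ hq => ?_⟩
  -- `j` turns the bound for `(8/7) ^ d` into one for `growth q Δ ^ d`
  obtain ⟨j, hj⟩ := pow_unbounded_of_one_lt (RealProg.growth q Δ : ℝ)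
    (show (1 : ℝ) < 8 / 7 by norm_num)
  refine ⟨276000 * (Δ + 1) * 3 ^ j + (2 * j + 4) + 32, ?_⟩
  intro N M hΔ hφ hf hγ δ hδ
  obtain ⟨d, t, hd, hd', ht, hrun⟩ := RealProg.fptas_runs hq hφ hf hΔ hδ
  have hacc := fun choices (h : MRF.Admissible choices) =>
    MRF.computeZ_accuracy hq hφ hf hγ hδ hd h
  have hadm : MRF.Admissible ((List.finRange N).map fun v => (v, (⟨0, hq⟩ : Fin q))) := by
    rw [MRF.Admissible, List.map_map]
    simp [Function.comp_def]
  refine ⟨d + 1, t, _, hrun, ?_, hacc _ hadm, by omega, ?_, ⟨_, hadm, rfl⟩, hacc⟩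
  all_goals
    have hδ' : 0 < 1 / δ := by positivity
    have hN := RealProg.le_size_left M
    have hqs := RealProg.card_alphabet_le_size M
    have hq1 : (1 : ℝ) ≤ q := by exact_mod_cast hq
    have hN0 : (0 : ℝ) ≤ N := Nat.cast_nonneg N
    obtain ⟨s, hs⟩ : ∃ s, s = M.size + 1 / δ := ⟨_, rfl⟩
    have hs1 : 1 ≤ s := by linarith
    have hNs : (N : ℝ) ≤ s := by linarith
    have hqs' : (q : ℝ) ≤ s := by linarith
    have hpow : (8 / 7 : ℝ) ^ (d + 1) ≤ 3 * s ^ 2 := RealProg.pow_depth_le hs1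
      (mul_le_mul hNs (by linarith) (by linarith) (by linarith)) hd'
  · rw [← hs]
    have hD : ((d + 1 : ℕ) : ℝ) ≤ 21 * s ^ 2 := by
      have := one_add_mul_le_pow (show (-2 : ℝ) ≤ 1 / 7 by norm_num) (d + 1)
      norm_num at this hpow ⊢
      linarith
    have hgr : (RealProg.growth q Δ : ℝ) ^ (d + 1) ≤ 3 ^ j * s ^ (2 * j) := by
      calc (RealProg.growth q Δ : ℝ) ^ (d + 1) ≤ ((8 / 7) ^ j) ^ (d + 1) := by gcongr
        _ = ((8 / 7) ^ (d + 1)) ^ j := by rw [← pow_mul, ← pow_mul, mul_comm]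
        _ ≤ (3 * s ^ 2) ^ j := by gcongr
        _ = _ := by rw [mul_pow, ← pow_mul]
    have hs2 : s ≤ s ^ 2 := by nlinarith
    have hΔ0 : (0 : ℝ) ≤ Δ := Nat.cast_nonneg Δ
    have h1 : (N : ℝ) + ((d + 1 : ℕ) : ℝ) * (Δ + 1) + 1 ≤ 23 * (Δ + 1) * s ^ 2 := by
      have : ((d + 1 : ℕ) : ℝ) * (Δ + 1) ≤ 21 * s ^ 2 * (Δ + 1) := by gcongr
      nlinarith [mul_nonneg hΔ0 (sq_nonneg s)]
    calc (t : ℝ) ≤ (N + 1) * (2 * ((RealProg.growth q Δ : ℝ) ^ (d + 1) *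
          (1000 * ((N + ((d + 1 : ℕ) : ℝ) * (Δ + 1) + 1) * (N + q + 1))))) := by
          exact_mod_cast ht
      _ ≤ (2 * s) * (2 * ((3 ^ j * s ^ (2 * j)) *
          (1000 * ((23 * (Δ + 1) * s ^ 2) * (3 * s))))) := by gcongr <;> linarith
      _ = 276000 * (Δ + 1) * 3 ^ j * s ^ (2 * j + 4) := by ring
      _ ≤ _ := by
        have hc : (276000 * (Δ + 1) * 3 ^ j : ℝ) ≤
            ((276000 * (Δ + 1) * 3 ^ j + (2 * j + 4) + 32 : ℕ) : ℝ) := by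
          push_cast
          have : (0 : ℝ) ≤ (Δ + 1) * 3 ^ j := by positivity
          have hj0 : (0 : ℝ) ≤ j := Nat.cast_nonneg j
          nlinarith
        exact mul_le_mul hc (pow_le_pow_right₀ hs1 (by omega)) (by positivity) (by positivity)
  · rw [add_assoc (1 : ℝ), ← hs]
    have hlog8 : (1 / 8 : ℝ) ≤ Real.log (8 / 7) := by
      have := Real.one_sub_inv_le_log_of_pos (show (0 : ℝ) < 8 / 7 by norm_num)
      norm_num at this ⊢
      exact this
    have h1 : ((d + 1 : ℕ) : ℝ) * Real.log (8 / 7) ≤ 4 * Real.log (1 + s) := by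
      rw [← Real.log_pow, show (4 : ℝ) = ((4 : ℕ) : ℝ) by norm_num, ← Real.log_pow]
      refine Real.log_le_log (by positivity) (hpow.trans ?_)
      nlinarith [sq_nonneg s, pow_pos (zero_lt_one.trans_le hs1) 3,
        pow_pos (zero_lt_one.trans_le hs1) 4]
    have hlog : 0 ≤ Real.log (1 + s) := Real.log_nonneg (by linarith)
    have h2 : ((d + 1 : ℕ) : ℝ) ≤ 32 * Real.log (1 + s) := by
      have : ((d + 1 : ℕ) : ℝ) * (1 / 8) ≤ ((d + 1 : ℕ) : ℝ) * Real.log (8 / 7) := by gcongr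
      linarith
    refine h2.trans (mul_le_mul_of_nonneg_right ?_ hlog)
    exact_mod_cast (by omega : 32 ≤ 276000 * (Δ + 1) * 3 ^ j + (2 * j + 4) + 32)
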